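/- Let $D\ge 1$ and let $S\subset\mathbb{R}^D$ be a finite data set. An RPTree-Max on $S$ is the random infinite binary tree of cells obtained by starting from a root cell that contains all of $S$ and splitting every cell $C$, with data $T=S\cap C$, as follows: choose $v$ uniformly at random on the unit sphere of $\mathbb{R}^D$ and, independently, $\delta$ uniformly at random in $[-1,1]\cdot 6\tilde\Delta/\sqrt D$, where $\tilde\Delta=\max_{y\in T}\|x-y\|$ for an arbitrarily chosen data point $x\in T$ (the choice of $x$ may depend on the position of the cell in the tree and on $T$); send $z\in T$ to the left child if $z\cdot v<\operatorname{median}\{z'\cdot v: z'\in T\}+\delta$ and to the right child otherwise. The choices of $(v,u)$, where $\delta=6u\tilde\Delta/\sqrt D$ with $u$ uniform in $[-1,1]$, are independent over all nodes of the tree. The radius of a cell $C$ is the radius of a smallest ball of $\mathbb{R}^D$ that contains $S\cap C$ ($0$ if $S\cap C=\emptyset$). The doubling dimension of a set $T\subset\mathbb{R}^D$ is the smallest integer $d\ge 0$ such that for every closed ball $B(x,r)\subset\mathbb{R}^D$, $r>0$, the set $B(x,r)\cap T$ can be covered by $2^d$ closed balls of radius $r/2$. Theorem. There is a universal constant $c_3>0$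 with the following property. Suppose an RPTree-Max is built using a finite data set $S\subset\mathbb{R}^D$. Pick any cell $C$ in the tree, and suppose that $S\cap C$ has doubling dimension at most $d$. Then for any real $s\ge 2$, with probability at least $1-\frac14$ over the randomization in constructing the subtree rooted at $C$ (the random choices made outside this subtree, and hence $C$, being fixed arbitrarily), every descendant $C'$ of $C$ that is more than $c_3\cdot\log s\cdot d\log(sd)$ levels below $C$ satisfies $\mathrm{radius}(C')\le \mathrm{radius}(C)/s$. (For $d=0$ the expression $d\log(sd)$ is read as $0$.) -/

import Mathlib

open MeasureTheory ProbabilityTheory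
open scoped NNReal ENNReal

namespace RPTree

/-- The ambient space `ℝ^D` with its Euclidean norm. -/
abbrev Pt (D : ℕ) : Type := EuclideanSpace ℝ (Fin D)

/-- For every ball `B(x, r)`, the set `B(x, r) ∩ S` can be covered by `2 ^ d` balls of radius
`r / 2` (balls are closed, and their centers may be any points of `ℝ^D`). -/
def IsDoubling {D : ℕ} (S : Set (Pt D)) (d : ℕ) : Prop :=
  ∀ (x : Pt D) (r : ℝ), 0 < r → ∃ c : Fin (2 ^ d) → Pt D,
    Metric.closedBall x r ∩ S ⊆ ⋃ i, Metric.closedBall (c i) (r / 2)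

/-- The doubling dimension of `S`: the least `d` with `IsDoubling S d` (`⊤` if there is none). -/
noncomputable def doublingDim {D : ℕ} (S : Set (Pt D)) : ℕ∞ :=
  ⨅ (d : ℕ) (_ : IsDoubling S d), (d : ℕ∞)

/-- The radius of a set of data points: the radius of a smallest enclosing ball
(`0` for the empty set). -/
noncomputable def radius {D : ℕ} (T : Finset (Pt D)) : ℝ :=
  sInf {r : ℝ | 0 ≤ r ∧ ∃ x : Pt D, (T : Set (Pt D)) ⊆ Metric.closedBall x r}

/-- The median of a finite multiset of reals: the middle element of the sorted list if the
number of elements is odd, the average of the two middle elements if it is even. -/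
noncomputable def median (m : Multiset ℝ) : ℝ :=
  ((m.sort (· ≤ ·)).getD ((Multiset.card m - 1) / 2) 0 +
    (m.sort (· ≤ ·)).getD (Multiset.card m / 2) 0) / 2

/-- The estimate `max {‖x - y‖ : y ∈ T}` of the radius of `T` seen from the point `x`. -/
noncomputable def spread {D : ℕ} (x : Pt D) (T : Finset (Pt D)) : ℝ :=
  ((T.sup fun y => nndist x y : ℝ≥0) : ℝ)

/-- The random choices made at one node: a direction `v`, and a number `u ∈ [-1, 1]` that
determines the offset `δ = u * 6 * spread / √D`. -/
abbrev Choice (D : ℕ) : Type := Pt D × ℝ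

/-- The threshold `median {z · v : z ∈ T} + δ` of the split of `T`, where `x` is the data point
from which the size of `T` is estimated. -/
noncomputable def threshold {D : ℕ} (x : Pt D) (T : Finset (Pt D)) (ξ : Choice D) : ℝ :=
  median (T.val.map fun z => inner ℝ z ξ.1) + ξ.2 * (6 * spread x T / Real.sqrt D)

open Classical in
/-- The two children of a cell with data `T`: the left child (`false`) receives the points whose
projection is below the threshold, the right child (`true`) receives all the others. -/
noncomputable def child {D : ℕ} (x : Pt D) (T : Finset (Pt D)) (ξ : Choice D) :
    Bool → Finset (Pt D)
  | false => T.filter fun z => inner ℝ z ξ.1 < threshold x T ξ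
  | true => T.filter fun z => ¬ inner ℝ z ξ.1 < threshold x T ξ

/-- A node of the infinite binary tree is addressed by the list of turns (`false` for left, `true`
for right) from the root to it, the last turn at the head: `[]` is the root, `b :: a` is the
`b`-child of `a`, and the descendants of `a` that are `k` levels below it are the `q ++ a` with
`q.length = k`. -/
abbrev Node : Type := List Bool

/-- The data `S ∩ C` of the cell `C` at a node of the tree built from the data set `S`, when
`ω a` are the random choices made at node `a` and `pick a T` is the data point used at node `a`,
whose cell has data `T`, to estimate the size of the cell. -/
noncomputable def cell {D : ℕ} (pick : Node → Finset (Pt D) → Pt D) (S : Finset (Pt D))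
    (ω : Node → Choice D) : Node → Finset (Pt D)
  | [] => S
  | b :: a => child (pick a (cell pick S ω a)) (cell pick S ω a) (ω a) b

/-- The choices `ω₀`, with those at the node `p` and all its descendants replaced by `ω`. -/
def resample {D : ℕ} (p : Node) (ω₀ ω : Node → Choice D) : Node → Choice D :=
  fun a => if p <:+ a then ω a else ω₀ a

/-- The uniform distribution on the unit sphere of `ℝ^D` (as a measure on `ℝ^D`). -/
noncomputable def directionLaw (D : ℕ) : Measure (Pt D) :=
  (((volume : Measure (Pt D)).toSphere)[|Set.univ]).map Subtype.val

/-- The uniform distribution on `[-1, 1]`. -/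
noncomputable def offsetLaw : Measure ℝ :=
  (volume : Measure ℝ)[|Set.Icc (-1) 1]

/-- The law of the random choices: independent over all nodes, and at each node a uniformly
random direction and an independent uniformly random number in `[-1, 1]`. -/
noncomputable def treeLaw (D : ℕ) : Measure (Node → Choice D) :=
  Measure.infinitePi fun _ : Node => (directionLaw D).prod offsetLaw

instance isProbabilityMeasure_directionLaw (D : ℕ) [NeZero D] :
    IsProbabilityMeasure (directionLaw D) := by
  have : Nonempty (Fin D) := ⟨0⟩
  have : IsProbabilityMeasure ((volume : Measure (Pt D)).toSphere)[|Set.univ] :=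
    cond_isProbabilityMeasure
      (by rw [ne_eq, Measure.measure_univ_eq_zero]; exact Measure.toSphere_ne_zero _)
  exact Measure.isProbabilityMeasure_map measurable_subtype_coe.aemeasurable

instance isProbabilityMeasure_offsetLaw : IsProbabilityMeasure offsetLaw :=
  cond_isProbabilityMeasure_of_finite (by simp) (by simp)

instance isProbabilityMeasure_treeLaw (D : ℕ) [NeZero D] : IsProbabilityMeasure (treeLaw D) := by
  unfold treeLaw; infer_instance

end RPTree

/-!
The idea is to follow pairs of small balls through the tree. Let `R` be the radius of the cell `C`,
and cover its data by `N ≤ (s d) ^ O(d)` balls of radius about `R / (s √d)`. As long as a cell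
contains two points at distance more than `Δ`, it meets two balls of the cover at distance at least
`Δ / 2`. A cell of diameter at most `2 Δ` splits such a pair well:

* the threshold falls between the two balls with probability bounded below. A random direction
  stretches the distance of two points as a Gaussian does (second and fourth moments of a
  coordinate), and the fourth moments also show that the median is close enough to both projections
  for the uniform offset to reach them;
* the threshold cuts one of the balls with much smaller probability. Indeed a doubling set of
  radius `r` has projected width of order `r √d / √D` only, by chaining over nets (all that is
  needed is the subgaussian tail of a coordinate).

Both children can meet both balls only if a ball is cut, so the expected number of children that
meet both balls is at most `1 - c` (`lintegral_meet_child_le`). In a cell of larger diameter this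
number is still at most one, because the probabilities of both events scale alike.

Hence the expected number of (cell, far pair) incidences never grows, and it decreases
geometrically in the phase in which the diameter has to drop from `2 Δ` to `Δ`. After
`K = O(d log (s d))` levels it is below `1 / (4 J)`, where `J = O(log s)` is the number of phases,
and a union bound over the phases gives the theorem. It is essential that pairs of balls are counted
and not cells: the number of cells grows with the level, but the same pairs serve in all phases. The
expectations are computed by first-step analysis (`treeLaw_failSet_succ_le`): the choices at a node
are independent of those below it.

The moments of a random direction come from a standard Gaussian vector `x`: for a unit vector `e`
and an independent random direction `v`, the number `‖x‖ ⟪e, v⟫` is a standard Gaussian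
(`lintegral_norm_mul_inner`), and Jensen's inequality removes the random length `‖x‖`.
-/

namespace RPTree

/-! ### Random directions -/

open scoped Pointwise in
theorem directionLaw_apply {D : ℕ} {s : Set (Pt D)} (hs : MeasurableSet s) :
    directionLaw D s = ((volume : Measure (Pt D)).toSphere Set.univ)⁻¹ *
      (D * volume (Set.Ioo (0 : ℝ) 1 • (s ∩ Metric.sphere 0 1))) := by
  rw [directionLaw, Measure.map_apply measurable_subtype_coe hs, cond_apply .univ, Set.univ_inter,
    Measure.toSphere_apply' _ (measurable_subtype_coe hs)]
  simp [Subtype.image_preimage_coe, Set.inter_comm]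

open scoped Pointwise in
/-- The uniform distribution on the sphere is invariant under linear isometries. -/
theorem map_directionLaw {D : ℕ} (L : Pt D ≃ₗᵢ[ℝ] Pt D) :
    (directionLaw D).map L = directionLaw D := by
  ext s hs
  have hL : Measurable L := L.continuous.measurable
  rw [Measure.map_apply hL hs, directionLaw_apply hs, directionLaw_apply (hL hs)]
  congr 2
  rw [← L.measurePreserving.measure_preimage_emb L.toHomeomorph.measurableEmbedding
    (Set.Ioo (0 : ℝ) 1 • (s ∩ Metric.sphere 0 1))]
  congr 1
  ext x
  simp only [Set.mem_smul, Set.mem_inter_iff, Set.mem_preimage, mem_sphere_iff_norm, sub_zero]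
  constructor
  · rintro ⟨r, hr, y, ⟨hy, hy1⟩, rfl⟩
    exact ⟨r, hr, L y, ⟨hy, by simpa using hy1⟩, by simp⟩
  · rintro ⟨r, hr, y, ⟨hy, hy1⟩, h⟩
    refine ⟨r, hr, L.symm y, ⟨by simpa using hy, by simpa using hy1⟩, ?_⟩
    apply L.injective
    simpa using h

theorem ae_norm_eq_one (D : ℕ) : ∀ᵐ v ∂directionLaw D, ‖v‖ = 1 := by
  refine (ae_map_iff measurable_subtype_coe.aemeasurable
    (measurableSet_eq_fun measurable_norm measurable_const)).2 ?_
  exact Filter.Eventually.of_forall fun v => by simp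

/-- By rotation invariance, the law of `⟪x, v⟫` depends only on the norm of `x`. -/
theorem lintegral_inner_congr {D : ℕ} {f : ℝ → ℝ≥0∞} (hf : Measurable f) {x y : Pt D}
    (h : ‖x‖ = ‖y‖) :
    ∫⁻ v, f (inner ℝ x v) ∂directionLaw D = ∫⁻ v, f (inner ℝ y v) ∂directionLaw D := by
  set L := Submodule.reflection (ℝ ∙ (x - y))ᗮ
  have hL : L x = y := Submodule.reflection_sub h
  conv_rhs => rw [← map_directionLaw L]
  rw [lintegral_map (by fun_prop) L.continuous.measurable]
  simp [← hL]

theorem map_inner_stdGaussian {D : ℕ} {v : Pt D} (hv : ‖v‖ = 1) :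
    (stdGaussian (Pt D)).map (fun x => inner ℝ v x) = gaussianReal 0 1 := by
  have := IsGaussian.map_eq_gaussianReal (μ := stdGaussian (Pt D)) (innerSL ℝ v)
  rw [variance_dual_stdGaussian, integral_strongDual_stdGaussian] at this
  simpa [hv] using this

/-- A standard Gaussian vector `x` is a uniform direction scaled by the independent length `‖x‖`;
tested on functions of one coordinate. -/
theorem lintegral_norm_mul_inner {D : ℕ} [NeZero D] {f : ℝ → ℝ≥0∞} (hf : Measurable f)
    {e : Pt D} (he : ‖e‖ = 1) :
    ∫⁻ v, ∫⁻ x, f (‖x‖ * inner ℝ e v) ∂stdGaussian (Pt D) ∂directionLaw D =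
      ∫⁻ t, f t ∂gaussianReal 0 1 := by
  rw [lintegral_lintegral_swap (by fun_prop)]
  have h1 (x : Pt D) : ∫⁻ v, f (‖x‖ * inner ℝ e v) ∂directionLaw D =
      ∫⁻ v, f (inner ℝ x v) ∂directionLaw D := by
    rw [← lintegral_inner_congr hf (x := ‖x‖ • e) (by simp [norm_smul, he])]
    simp [real_inner_smul_left]
  simp_rw [h1]
  rw [lintegral_lintegral_swap (by fun_prop)]
  have h2 : ∀ᵐ v ∂directionLaw D, ∫⁻ x, f (inner ℝ x v) ∂stdGaussian (Pt D) =
      ∫⁻ t, f t ∂gaussianReal 0 1 := by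
    filter_upwards [ae_norm_eq_one D] with v hv
    rw [← map_inner_stdGaussian hv, lintegral_map hf (by fun_prop)]
    simp_rw [real_inner_comm]
  rw [lintegral_congr_ae h2]
  simp

theorem lintegral_sq_gaussianReal :
    ∫⁻ t, ENNReal.ofReal (t ^ 2) ∂gaussianReal 0 1 = 1 := by
  have h := variance_id_gaussianReal (μ := 0) (v := 1)
  rw [variance_eq_integral (by fun_prop)] at h
  rw [← ofReal_integral_eq_lintegral_ofReal]
  · simp at h
    simp [h]
  · exact (memLp_id_gaussianReal' 2 (by simp)).integrable_sq
  · exact Filter.Eventually.of_forall fun t => by positivity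

theorem integrable_norm_sq_stdGaussian (D : ℕ) :
    Integrable (fun x : Pt D => ‖x‖ ^ 2) (stdGaussian (Pt D)) :=
  (IsGaussian.memLp_two_id (μ := stdGaussian (Pt D))).integrable_norm_pow (by simp)

theorem integral_norm_sq_stdGaussian (D : ℕ) :
    ∫ x, ‖x‖ ^ 2 ∂stdGaussian (Pt D) = D := by
  have h1 (i : Fin D) : ∫⁻ x, ENNReal.ofReal (x i ^ 2) ∂stdGaussian (Pt D) = 1 := by
    rw [← lintegral_sq_gaussianReal,
      ← map_inner_stdGaussian (v := EuclideanSpace.single i (1 : ℝ)) (by simp),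
      lintegral_map (by fun_prop) (by fun_prop)]
    simp [EuclideanSpace.inner_single_left]
  rw [integral_eq_lintegral_of_nonneg_ae (Filter.Eventually.of_forall fun t => by positivity)
    (by fun_prop)]
  simp_rw [EuclideanSpace.real_norm_sq_eq]
  simp_rw [ENNReal.ofReal_sum_of_nonneg fun i _ => sq_nonneg _]
  rw [lintegral_finsetSum _ (by fun_prop)]
  simp [h1]

theorem lintegral_sq_inner {D : ℕ} [NeZero D] {e : Pt D} (he : ‖e‖ = 1) :
    ∫⁻ v, ENNReal.ofReal (inner ℝ e v ^ 2) ∂directionLaw D = (D : ℝ≥0∞)⁻¹ := by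
  have h := lintegral_norm_mul_inner (f := fun t => ENNReal.ofReal (t ^ 2)) (by fun_prop) he
  rw [lintegral_sq_gaussianReal] at h
  simp_rw [mul_pow, ENNReal.ofReal_mul (sq_nonneg _)] at h
  simp_rw [lintegral_mul_const' _ _ ENNReal.ofReal_ne_top] at h
  rw [← ofReal_integral_eq_lintegral_ofReal (integrable_norm_sq_stdGaussian D)
    (Filter.Eventually.of_forall fun t => by positivity), integral_norm_sq_stdGaussian,
    lintegral_const_mul' _ _ ENNReal.ofReal_ne_top] at h
  rw [ENNReal.ofReal_natCast] at h
  rw [mul_comm] at h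
  exact ENNReal.eq_inv_of_mul_eq_one_left h

/-- Jensen's inequality in the length of a Gaussian vector: a coordinate of a random direction,
rescaled by `√D`, is dominated by a standard Gaussian for all convex functions of the square. -/
theorem lintegral_convex_inner_le {D : ℕ} [NeZero D] {φ : ℝ → ℝ} (hφ : ConvexOn ℝ Set.univ φ)
    (hc : Continuous φ) (h0 : ∀ t, 0 ≤ φ t) {e : Pt D} (he : ‖e‖ = 1) :
    ∫⁻ v, ENNReal.ofReal (φ (D * inner ℝ e v ^ 2)) ∂directionLaw D ≤
      ∫⁻ t, ENNReal.ofReal (φ (t ^ 2)) ∂gaussianReal 0 1 := by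
  rw [← lintegral_norm_mul_inner (f := fun t => ENNReal.ofReal (φ (t ^ 2))) (by fun_prop) he]
  refine lintegral_mono fun v => ?_
  set a : ℝ := inner ℝ e v
  by_cases hi : Integrable (fun x : Pt D => φ ((‖x‖ * a) ^ 2)) (stdGaussian (Pt D))
  · rw [← ofReal_integral_eq_lintegral_ofReal hi (Filter.Eventually.of_forall fun t => h0 _)]
    apply ENNReal.ofReal_le_ofReal
    have hX : Integrable (fun x : Pt D => (‖x‖ * a) ^ 2) (stdGaussian (Pt D)) := by
      simp_rw [mul_pow]
      exact (integrable_norm_sq_stdGaussian D).mul_const _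
    have := hφ.map_integral_le hc.continuousOn isClosed_univ (by simp) hX hi
    refine le_trans (le_of_eq ?_) this
    simp_rw [mul_pow]
    rw [integral_mul_const, integral_norm_sq_stdGaussian]
  · have : ∫⁻ x, ENNReal.ofReal (φ ((‖x‖ * a) ^ 2)) ∂stdGaussian (Pt D) = ∞ := by
      by_contra hne
      apply hi
      refine ⟨by fun_prop, ?_⟩
      rw [hasFiniteIntegral_iff_ofReal (Filter.Eventually.of_forall fun t => h0 _)]
      exact Ne.lt_top hne
    simp only [this]
    exact le_top

theorem lintegral_gaussianReal_ofReal {f : ℝ → ℝ} (hf : Measurable f) (h0 : ∀ t, 0 ≤ f t)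
    (hi : Integrable (fun t => f t * Real.exp (-(1 / 2) * t ^ 2))) :
    ∫⁻ t, ENNReal.ofReal (f t) ∂gaussianReal 0 1 =
      ENNReal.ofReal ((√(2 * Real.pi))⁻¹ * ∫ t, f t * Real.exp (-(1 / 2) * t ^ 2)) := by
  rw [gaussianReal_of_var_ne_zero _ one_ne_zero,
    lintegral_withDensity_eq_lintegral_mul _ (by fun_prop) (by fun_prop), ← integral_const_mul,
    ofReal_integral_eq_lintegral_ofReal (hi.const_mul _)
      (Filter.Eventually.of_forall fun t => by have := h0 t; positivity)]
  refine lintegral_congr fun t => ?_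
  simp only [Pi.mul_apply, gaussianPDF, gaussianPDFReal, NNReal.coe_one, mul_one, sub_zero]
  rw [← ENNReal.ofReal_mul (by positivity)]
  congr 1
  rw [show -t ^ 2 / 2 = -(1 / 2) * t ^ 2 by ring]
  ring

theorem lintegral_exp_sq_gaussianReal :
    ∫⁻ t, ENNReal.ofReal (Real.exp (t ^ 2 / 4)) ∂gaussianReal 0 1 ≤ 2 := by
  have h (t : ℝ) : Real.exp (t ^ 2 / 4) * Real.exp (-(1 / 2) * t ^ 2) =
      Real.exp (-(1 / 4) * t ^ 2) := by
    rw [← Real.exp_add]; ring_nf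
  rw [lintegral_gaussianReal_ofReal (by fun_prop) (fun t => by positivity)]
  · simp_rw [h]
    rw [integral_gaussian]
    rw [show (2 : ℝ≥0∞) = ENNReal.ofReal 2 by simp]
    apply ENNReal.ofReal_le_ofReal
    rw [inv_mul_le_iff₀ (by positivity)]
    rw [show Real.pi / (1 / 4) = (2 * Real.pi) * 2 by ring, Real.sqrt_mul (by positivity)]
    gcongr
    rw [Real.sqrt_le_left] <;> norm_num
  · simp_rw [h]
    exact integrable_exp_neg_mul_sq (by norm_num)

theorem lintegral_pow_four_gaussianReal :
    ∫⁻ t, ENNReal.ofReal ((t ^ 2) ^ 2) ∂gaussianReal 0 1 ≤ 3 := by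
  have hint : Integrable fun t : ℝ => (t ^ 2) ^ 2 * Real.exp (-(1 / 2) * t ^ 2) := by
    have := integrable_rpow_mul_exp_neg_mul_sq (b := 1 / 2) (by norm_num) (s := 4) (by norm_num)
    refine this.congr (Filter.Eventually.of_forall fun t => ?_)
    norm_cast
    ring
  rw [lintegral_gaussianReal_ofReal (by fun_prop) (fun t => by positivity) hint]
  rw [show (3 : ℝ≥0∞) = ENNReal.ofReal 3 by simp]
  apply ENNReal.ofReal_le_ofReal
  have hg : Real.Gamma (5 / 2) = 3 / 4 * √Real.pi := by
    rw [show (5 / 2 : ℝ) = (1 / 2 + 1) + 1 by norm_num, Real.Gamma_add_one (by norm_num),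
      Real.Gamma_add_one (by norm_num), Real.Gamma_one_half_eq]
    ring
  have h1 := integral_comp_abs (f := fun t : ℝ => (t ^ 2) ^ 2 * Real.exp (-(1 / 2) * t ^ 2))
  simp only [sq_abs] at h1
  have h2 := integral_rpow_mul_exp_neg_mul_rpow (p := 2) (q := 4) (b := 1 / 2)
    (by norm_num) (by norm_num) (by norm_num)
  have h3 : ∫ t in Set.Ioi (0 : ℝ), (t ^ 2) ^ 2 * Real.exp (-(1 / 2) * t ^ 2) =
      ∫ x in Set.Ioi (0 : ℝ), x ^ (4 : ℝ) * Real.exp (-(1 / 2) * x ^ (2 : ℝ)) := by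
    congr 1; ext t; norm_cast; ring_nf
  rw [h1, h3, h2, show ((4 + 1) / 2 : ℝ) = 5 / 2 by norm_num, hg]
  rw [show (-(4 + 1) / 2 : ℝ) = -(2 + 1 / 2) by norm_num, one_div, Real.inv_rpow (by norm_num),
    Real.rpow_neg (by norm_num), Real.rpow_add (by norm_num), inv_inv,
    show (2 : ℝ) ^ (2⁻¹ : ℝ) = √2 by rw [Real.sqrt_eq_rpow, one_div], Real.sqrt_mul (by norm_num)]
  norm_num
  field_simp
  norm_num

theorem integrable_directionLaw {D : ℕ} [NeZero D] {F : Pt D → ℝ} (hF : Continuous F) :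
    Integrable F (directionLaw D) := by
  have h : (directionLaw D).restrict (Metric.sphere 0 1) = directionLaw D := by
    refine Measure.restrict_eq_self_of_ae_mem ?_
    filter_upwards [ae_norm_eq_one D] with v hv
    simpa using hv
  rw [← h]
  exact hF.continuousOn.integrableOn_compact (isCompact_sphere 0 1)

theorem lintegral_inner_eq_lintegral_norm_mul {D : ℕ} [NeZero D] {f : ℝ → ℝ≥0∞}
    (hf : Measurable f) (w : Pt D) :
    ∫⁻ v, f (inner ℝ w v) ∂directionLaw D =
      ∫⁻ v, f (‖w‖ * inner ℝ (EuclideanSpace.single 0 1 : Pt D) v) ∂directionLaw D := by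
  rw [lintegral_inner_congr hf (y := ‖w‖ • (EuclideanSpace.single 0 1 : Pt D))
    (by simp [norm_smul])]
  simp only [real_inner_smul_left]

theorem integral_sq_inner {D : ℕ} [NeZero D] (w : Pt D) :
    ∫ v, inner ℝ w v ^ 2 ∂directionLaw D = ‖w‖ ^ 2 / D := by
  rw [integral_eq_lintegral_of_nonneg_ae (Filter.Eventually.of_forall fun t => by positivity)
    (by fun_prop), lintegral_inner_eq_lintegral_norm_mul (f := fun t => ENNReal.ofReal (t ^ 2))
    (by fun_prop) w]
  simp_rw [mul_pow, ENNReal.ofReal_mul (sq_nonneg _)]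
  rw [lintegral_const_mul' _ _ ENNReal.ofReal_ne_top, lintegral_sq_inner (by simp)]
  simp [ENNReal.toReal_mul, div_eq_mul_inv]

theorem integral_pow_four_inner_le {D : ℕ} [NeZero D] (w : Pt D) :
    ∫ v, inner ℝ w v ^ 4 ∂directionLaw D ≤ 3 * ‖w‖ ^ 4 / D ^ 2 := by
  have hD : (0 : ℝ) < D := by exact_mod_cast NeZero.pos D
  have h := (lintegral_convex_inner_le (φ := fun t => t ^ 2) (Even.convexOn_pow even_two)
    (by fun_prop) (fun t => by positivity) (e := (EuclideanSpace.single 0 1 : Pt D))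
    (by simp)).trans lintegral_pow_four_gaussianReal
  rw [← ofReal_integral_eq_lintegral_ofReal (integrable_directionLaw (by fun_prop))
    (Filter.Eventually.of_forall fun t => by positivity), ENNReal.ofReal_le_ofNat] at h
  rw [integral_eq_lintegral_of_nonneg_ae (Filter.Eventually.of_forall fun t => by positivity)
    (by fun_prop), lintegral_inner_eq_lintegral_norm_mul (f := fun t => ENNReal.ofReal (t ^ 4))
    (by fun_prop) w, ← integral_eq_lintegral_of_nonneg_ae
    (Filter.Eventually.of_forall fun t => by positivity) (by fun_prop)]
  simp_rw [mul_pow] at h ⊢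
  rw [integral_const_mul] at h ⊢
  simp_rw [← pow_mul] at h
  norm_num at h
  rw [le_div_iff₀ (by positivity)]
  nlinarith [mul_le_mul_of_nonneg_left h (show 0 ≤ ‖w‖ ^ 4 by positivity)]

/-- The projection on a random direction is subgaussian, at the scale `‖w‖ / √D`. -/
theorem integral_exp_sq_inner_le {D : ℕ} [NeZero D] {w : Pt D} {R : ℝ} (hR : 0 < R)
    (hw : ‖w‖ ≤ R) :
    ∫ v, Real.exp (D * inner ℝ w v ^ 2 / (4 * R ^ 2)) ∂directionLaw D ≤ 2 := by
  have hc : ConvexOn ℝ Set.univ fun t : ℝ => Real.exp (t / 4) := by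
    refine ⟨convex_univ, fun x _ y _ a b ha hb hab => ?_⟩
    have := convexOn_exp.2 (Set.mem_univ (x / 4)) (Set.mem_univ (y / 4)) ha hb hab
    simp only [smul_eq_mul] at this ⊢
    rwa [show (a * x + b * y) / 4 = a * (x / 4) + b * (y / 4) by ring]
  have h := (lintegral_convex_inner_le hc (by fun_prop) (fun t => by positivity)
    (e := (EuclideanSpace.single 0 1 : Pt D)) (by simp)).trans lintegral_exp_sq_gaussianReal
  refine ENNReal.ofReal_le_ofNat.1 (le_trans ?_ h)
  rw [ofReal_integral_eq_lintegral_ofReal (integrable_directionLaw (by fun_prop))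
    (Filter.Eventually.of_forall fun t => by positivity),
    lintegral_inner_eq_lintegral_norm_mul
      (f := fun t => ENNReal.ofReal (Real.exp (D * t ^ 2 / (4 * R ^ 2)))) (by fun_prop) w]
  refine lintegral_mono fun v => ENNReal.ofReal_le_ofReal (Real.exp_le_exp.2 ?_)
  set a : ℝ := inner ℝ (EuclideanSpace.single 0 1 : Pt D) v
  rw [div_le_div_iff₀ (by positivity) (by norm_num)]
  have : ‖w‖ ^ 2 ≤ R ^ 2 := by gcongr
  have h2 := mul_le_mul_of_nonneg_left this (show 0 ≤ D * a ^ 2 * 4 by positivity)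
  nlinarith

/-! ### Doubling sets and the width of their projections -/

theorem IsDoubling.subset {D d : ℕ} {S S' : Set (Pt D)} (h : IsDoubling S d) (hS : S' ⊆ S) :
    IsDoubling S' d := fun x r hr => by
  obtain ⟨c, hc⟩ := h x r hr
  exact ⟨c, (Set.inter_subset_inter_right _ hS).trans hc⟩

theorem IsDoubling.mono {D d d' : ℕ} {S : Set (Pt D)} (h : IsDoubling S d) (hd : d ≤ d') :
    IsDoubling S d' := fun x r hr => by
  obtain ⟨c, hc⟩ := h x r hr
  have hp : 2 ^ d ≤ 2 ^ d' := Nat.pow_le_pow_right (by norm_num) hd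
  refine ⟨fun i => if hi : i.1 < 2 ^ d then c ⟨i, hi⟩ else 0, fun z hz => ?_⟩
  obtain ⟨i, hi⟩ := Set.mem_iUnion.1 (hc hz)
  exact Set.mem_iUnion.2 ⟨i.castLE hp, by simpa using hi⟩

theorem isDoubling_of_doublingDim_le {D d : ℕ} {S : Set (Pt D)} (h : doublingDim S ≤ d) :
    IsDoubling S d := by
  by_contra hn
  have : ((d + 1 : ℕ) : ℕ∞) ≤ doublingDim S := by
    refine le_iInf₂ fun k hk => ?_
    by_contra hlt
    exact hn (hk.mono (by norm_cast at hlt; omega))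
  have := this.trans h
  norm_cast at this
  omega

theorem IsDoubling.exists_cover {D d : ℕ} {S : Set (Pt D)} (h : IsDoubling S d) (x : Pt D) {r : ℝ}
    (hr : 0 < r) (m : ℕ) :
    ∃ C : Finset (Pt D), C.card ≤ 2 ^ (d * m) ∧
      ∀ z ∈ S, z ∈ Metric.closedBall x r → ∃ c ∈ C, z ∈ Metric.closedBall c (r / 2 ^ m) := by
  classical
  induction m with
  | zero => exact ⟨{x}, by simp, fun z _ hz => ⟨x, by simp, by simpa using hz⟩⟩
  | succ m ih =>
    obtain ⟨C, hC, hcov⟩ := ih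
    choose f hf using fun c : Pt D => h c (r / 2 ^ m) (by positivity)
    refine ⟨C.biUnion fun c => Finset.univ.image (f c), ?_, fun z hz hzx => ?_⟩
    · refine (Finset.card_biUnion_le_card_mul _ _ (2 ^ d) fun c _ => ?_).trans ?_
      · exact Finset.card_image_le.trans (by simp)
      · calc C.card * 2 ^ d ≤ 2 ^ (d * m) * 2 ^ d := Nat.mul_le_mul_right _ hC
          _ = 2 ^ (d * (m + 1)) := by rw [← pow_add]; ring_nf
    · obtain ⟨c, hc, hzc⟩ := hcov z hz hzx
      obtain ⟨i, hi⟩ := Set.mem_iUnion.1 (hf c ⟨hzc, hz⟩)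
      refine ⟨f c i, ?_, ?_⟩
      · exact Finset.mem_biUnion.2 ⟨c, hc, Finset.mem_image_of_mem _ (Finset.mem_univ _)⟩
      · rwa [div_div, ← pow_succ] at hi

/-- The part of a doubling set in a ball has nets that consist of its own points. -/
theorem IsDoubling.exists_net {D d : ℕ} {S : Set (Pt D)} (h : IsDoubling S d) (x : Pt D) {r : ℝ}
    (hr : 0 < r) (m : ℕ) :
    ∃ N : Finset (Pt D), N.card ≤ 2 ^ (d * m) ∧ (N : Set (Pt D)) ⊆ S ∩ Metric.closedBall x r ∧
      ∀ z ∈ S ∩ Metric.closedBall x r, ∃ y ∈ N, ‖z - y‖ ≤ 2 * r / 2 ^ m := by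
  classical
  obtain ⟨C, hC, hcov⟩ := h.exists_cover x hr m
  set P : Pt D → Prop := fun c => ∃ z ∈ S ∩ Metric.closedBall x r,
    z ∈ Metric.closedBall c (r / 2 ^ m)
  choose! g hg using fun (c : Pt D) (hc : P c) => hc
  refine ⟨(C.filter P).image g, (Finset.card_image_le.trans (Finset.card_filter_le _ _)).trans hC,
    ?_, fun z hz => ?_⟩
  · intro y hy
    simp only [Finset.coe_image, Set.mem_image, Finset.mem_coe, Finset.mem_filter] at hy
    obtain ⟨c, ⟨_, hc⟩, rfl⟩ := hy
    exact (hg c hc).1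
  · obtain ⟨c, hc, hzc⟩ := hcov z hz.1 hz.2
    have hP : P c := ⟨z, hz, hzc⟩
    refine ⟨g c, Finset.mem_image_of_mem _ (Finset.mem_filter.2 ⟨hc, hP⟩), ?_⟩
    have h1 := (hg c hP).2
    rw [Metric.mem_closedBall] at h1 hzc
    calc ‖z - g c‖ = dist z (g c) := (dist_eq_norm _ _).symm
      _ ≤ dist z c + dist (g c) c := dist_triangle_right _ _ _
      _ ≤ r / 2 ^ m + r / 2 ^ m := add_le_add hzc h1
      _ = 2 * r / 2 ^ m := by ring

/-- Maximal inequality: the largest of `n` projections of vectors of length at most `R` on a random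
direction is of order `R √(log n / D)`. The majorant is continuous, so that measurability of the
maximum is no issue; the parameter `A` is to be chosen of order `√(log n)`. -/
theorem exists_majorant_of_card_le {D : ℕ} [NeZero D] (P : Finset (Pt D)) {R α A : ℝ} (hR : 0 < R)
    (hP : ∀ w ∈ P, ‖w‖ ≤ R) (hα : 1 ≤ α) (hcard : 2 * (P.card : ℝ) ≤ α) (hA : 0 < A) :
    ∃ g : Pt D → ℝ, Continuous g ∧ (∀ v, ∀ w ∈ P, |inner ℝ w v| ≤ g v) ∧ (∀ v, 0 ≤ g v) ∧
      ∫ v, g v ∂directionLaw D ≤ R / √D * (A / 2 + 2 / A * Real.log α) := by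
  have hD : (0 : ℝ) < D := by exact_mod_cast NeZero.pos D
  have hα0 : 0 < α := by linarith
  set X : Pt D → ℝ := fun v => ∑ w ∈ P, Real.exp (D * inner ℝ w v ^ 2 / (4 * R ^ 2)) with hX
  have hXc : Continuous X := by fun_prop
  have hX0 (v : Pt D) : 0 ≤ X v := Finset.sum_nonneg fun _ _ => (Real.exp_pos _).le
  have hlog := Real.log_nonneg hα
  set g : Pt D → ℝ := fun v => R / √D * (A / 2 + 2 / A * (Real.log α - 1 + X v / α)) with hg
  have key (v w : Pt D) (hw : w ∈ P) : |inner ℝ w v| ≤ g v := by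
    set u : ℝ := √D * |inner ℝ w v| / R with hu
    have hu0 : 0 ≤ u := by positivity
    have h1 : Real.exp (u ^ 2 / 4) ≤ X v := by
      have : u ^ 2 / 4 = D * inner ℝ w v ^ 2 / (4 * R ^ 2) := by
        rw [hu, div_pow, mul_pow, Real.sq_sqrt hD.le, sq_abs]
        field_simp
      rw [this]
      exact Finset.single_le_sum
        (f := fun w => Real.exp (D * inner ℝ w v ^ 2 / (4 * R ^ 2)))
        (fun _ _ => (Real.exp_pos _).le) hw
    have h2 : u ^ 2 / 4 ≤ Real.log α - 1 + X v / α := by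
      -- the tangent of `log` at `α`, an upper bound of the expectation of `X`
      have h3 := Real.add_one_le_exp (u ^ 2 / 4 - Real.log α)
      rw [Real.exp_sub, Real.exp_log hα0] at h3
      have : Real.exp (u ^ 2 / 4) / α ≤ X v / α := by gcongr
      linarith
    have h4 : u ≤ A / 2 + 2 / A * (u ^ 2 / 4) := by
      have : A / 2 + 2 / A * (u ^ 2 / 4) - u = (A - u) ^ 2 / (2 * A) := by field_simp; ring
      have : 0 ≤ (A - u) ^ 2 / (2 * A) := by positivity
      linarith
    have h5 : |inner ℝ w v| = R / √D * u := by rw [hu]; field_simp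
    have h6 : 2 / A * (u ^ 2 / 4) ≤ 2 / A * (Real.log α - 1 + X v / α) :=
      mul_le_mul_of_nonneg_left h2 (by positivity)
    rw [h5]
    exact mul_le_mul_of_nonneg_left (by linarith) (by positivity)
  have hint : ∫ v, X v ∂directionLaw D ≤ α := by
    rw [hX, integral_finsetSum _ fun w _ => integrable_directionLaw (by fun_prop)]
    refine le_trans (Finset.sum_le_card_nsmul _ _ 2 fun w hw =>
      integral_exp_sq_inner_le hR (hP w hw)) ?_
    rw [nsmul_eq_mul]
    linarith
  obtain rfl | ⟨w, hw⟩ := P.eq_empty_or_nonempty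
  · exact ⟨fun _ => 0, continuous_const, by simp, by simp, by simp; positivity⟩
  refine ⟨g, by fun_prop, fun v w hw => key v w hw, fun v => (abs_nonneg _).trans (key v w hw), ?_⟩
  have hXi : Integrable X (directionLaw D) := integrable_directionLaw hXc
  have : ∫ v, g v ∂directionLaw D =
      R / √D * (A / 2 + 2 / A * (Real.log α - 1 + (∫ v, X v ∂directionLaw D) / α)) := by
    rw [hg, integral_const_mul, integral_add (integrable_const _)
      (integrable_directionLaw (by fun_prop)), integral_const_mul,
      integral_add (integrable_const _) (integrable_directionLaw (by fun_prop)),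
      integral_div α X]
    simp
  rw [this]
  have : (∫ v, X v ∂directionLaw D) / α ≤ 1 := (div_le_one hα0).2 hint
  gcongr
  linarith

/-- Chaining: the expected width of the projection of the points of a doubling set in a ball of
radius `r` is at most of order `r √d / √D`. The width is replaced by a continuous majorant `g`, the
sum over the scales `r / 2 ^ m` of bounds for the increments between successive nets. -/
theorem IsDoubling.exists_width_majorant {D d : ℕ} [NeZero D] {S : Set (Pt D)}
    (h : IsDoubling S d) (hd : 1 ≤ d) {x b : Pt D} {r : ℝ} (hr : 0 < r)
    (hb : b ∈ S ∩ Metric.closedBall x r) :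
    ∃ g : Pt D → ℝ, Continuous g ∧ (∀ v, 0 ≤ g v) ∧
      (∀ v, ∀ z ∈ S ∩ Metric.closedBall x r, |inner ℝ (z - b) v| ≤ g v) ∧
      ∫ v, g v ∂directionLaw D ≤ 21 * r * √d / √D := by
  classical
  have hD : (0 : ℝ) < D := by exact_mod_cast NeZero.pos D
  have hd0 : (0 : ℝ) < d := by exact_mod_cast hd
  choose N' hcard' hsub' hnet' using fun m => h.exists_net x hr m
  obtain ⟨N, hN0, hN⟩ : ∃ N : ℕ → Finset (Pt D), N 0 = {b} ∧ ∀ m, (N m).card ≤ 2 ^ (d * m) ∧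
      ((N m : Set (Pt D)) ⊆ S ∩ Metric.closedBall x r) ∧
      ∀ z ∈ S ∩ Metric.closedBall x r, ∃ y ∈ N m, ‖z - y‖ ≤ 2 * r / 2 ^ m := by
    refine ⟨fun m => if m = 0 then {b} else N' m, by simp, fun m => ?_⟩
    by_cases hm : m = 0
    · subst hm
      refine ⟨by simp, by simpa using hb, fun z hz => ⟨b, by simp, ?_⟩⟩
      have h1 := hz.2
      have h2 := hb.2
      rw [Metric.mem_closedBall] at h1 h2
      rw [← dist_eq_norm]
      refine (dist_triangle_right _ _ x).trans ?_
      norm_num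
      linarith
    · simp only [hm, if_false]
      exact ⟨hcard' m, hsub' m, hnet' m⟩
  -- `10 - (2 M + 10) / 2 ^ M` is the sum of `(m + 4) / 2 ^ m` over `m < M`
  have step (M : ℕ) : ∃ g : Pt D → ℝ, Continuous g ∧ (∀ v, 0 ≤ g v) ∧
      (∀ v, ∀ z ∈ N M, |inner ℝ (z - b) v| ≤ g v) ∧
      ∫ v, g v ∂directionLaw D ≤ 2 * r * √d / √D * (10 - (2 * M + 10) / 2 ^ M) := by
    induction M with
    | zero => exact ⟨fun _ => 0, continuous_const, by simp, by simp [hN0], by simp⟩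
    | succ M ih =>
      obtain ⟨g, hgc, hg0, hg, hgi⟩ := ih
      set P : Finset (Pt D) := ((N (M + 1) ×ˢ N M).image fun y => y.1 - y.2).filter
        fun w => ‖w‖ ≤ 2 * r / 2 ^ M with hP
      have hPcard : (P.card : ℝ) ≤ 2 ^ (2 * d * (M + 1)) := by
        have : P.card ≤ 2 ^ (2 * d * (M + 1)) := by
          refine (Finset.card_filter_le _ _).trans (Finset.card_image_le.trans ?_)
          rw [Finset.card_product]
          calc (N (M + 1)).card * (N M).card ≤ 2 ^ (d * (M + 1)) * 2 ^ (d * M) :=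
                Nat.mul_le_mul (hN _).1 (hN _).1
            _ ≤ 2 ^ (2 * d * (M + 1)) := by
                rw [← pow_add]
                exact Nat.pow_le_pow_right (by norm_num) (by nlinarith)
        exact_mod_cast this
      obtain ⟨i, hic, hi, hi0, hii⟩ := exists_majorant_of_card_le P (R := 2 * r / 2 ^ M)
        (α := 2 * 2 ^ (2 * d * (M + 1))) (A := 2 * √d * (M + 1)) (by positivity)
        (fun w hw => (Finset.mem_filter.1 hw).2)
        (by nlinarith [one_le_pow₀ (n := 2 * d * (M + 1)) (show (1 : ℝ) ≤ 2 by norm_num)])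
        (by linarith) (by positivity)
      refine ⟨fun v => g v + i v, by fun_prop, fun v => add_nonneg (hg0 v) (hi0 v),
        fun v z hz => ?_, ?_⟩
      · obtain ⟨y, hy, hzy⟩ := (hN M).2.2 z ((hN (M + 1)).2.1 hz)
        have h1 := hi v (z - y) (Finset.mem_filter.2 ⟨Finset.mem_image.2
          ⟨(z, y), Finset.mem_product.2 ⟨hz, hy⟩, rfl⟩, hzy⟩)
        have h2 := hg v y hy
        calc |inner ℝ (z - b) v| = |inner ℝ (y - b) v + inner ℝ (z - y) v| := by
              rw [← inner_add_left]; congr 2; abel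
          _ ≤ _ := (abs_add_le _ _).trans (add_le_add h2 h1)
      · rw [integral_add (integrable_directionLaw hgc) (integrable_directionLaw hic)]
        have hlog : Real.log (2 * 2 ^ (2 * d * (M + 1))) ≤ 3 * (d * (M + 1)) := by
          rw [← pow_succ', Real.log_pow]
          have hl := Real.log_two_lt_d9
          have hl0 := Real.log_pos (show (1 : ℝ) < 2 by norm_num)
          have : (1 : ℝ) ≤ d * (M + 1) := by
            have : (1 : ℝ) ≤ d := by exact_mod_cast hd
            nlinarith [(Nat.cast_nonneg M : (0 : ℝ) ≤ M)]
          push_cast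
          nlinarith
        have hsd : √(d : ℝ) * √d = d := Real.mul_self_sqrt hd0.le
        have hs : (2 * √d * (M + 1)) / 2 + 2 / (2 * √d * (M + 1)) * (3 * (d * (M + 1))) =
            √d * (M + 4) := by
          field_simp
          nlinarith
        calc _ ≤ 2 * r * √d / √D * (10 - (2 * M + 10) / 2 ^ M) +
              2 * r / 2 ^ M / √D * ((2 * √d * (M + 1)) / 2 +
                2 / (2 * √d * (M + 1)) * (3 * (d * (M + 1)))) := by
              refine add_le_add hgi (hii.trans (mul_le_mul_of_nonneg_left ?_ (by positivity)))
              exact add_le_add_right (mul_le_mul_of_nonneg_left hlog (by positivity)) _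
          _ = _ := by
              rw [hs]
              push_cast
              rw [pow_succ]
              field_simp
              ring
  -- the chain is stopped at a scale so fine that the Cauchy-Schwarz inequality suffices
  obtain ⟨M, hM⟩ := exists_pow_lt_of_lt_one (show 0 < √d / √D / 2 by positivity)
    (show (1 / 2 : ℝ) < 1 by norm_num)
  obtain ⟨g, hgc, hg0, hg, hgi⟩ := step M
  refine ⟨fun v => g v + 2 * r / 2 ^ M * ‖v‖, by fun_prop,
    fun v => add_nonneg (hg0 v) (by positivity), fun v z hz => ?_, ?_⟩
  · obtain ⟨y, hy, hzy⟩ := (hN M).2.2 z hz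
    calc |inner ℝ (z - b) v| = |inner ℝ (y - b) v + inner ℝ (z - y) v| := by
          rw [← inner_add_left]; congr 2; abel
      _ ≤ g v + ‖z - y‖ * ‖v‖ :=
          (abs_add_le _ _).trans (add_le_add (hg v y hy) (abs_real_inner_le_norm _ _))
      _ ≤ _ := add_le_add_right (mul_le_mul_of_nonneg_right hzy (norm_nonneg v)) _
  · rw [integral_add (integrable_directionLaw hgc) (integrable_directionLaw (by fun_prop)),
      integral_const_mul]
    have hn : ∫ v, ‖v‖ ∂directionLaw D = 1 := by
      rw [integral_congr_ae (ae_norm_eq_one D)]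
      simp
    rw [hn]
    have h1 : 2 * r / 2 ^ M ≤ r * (√d / √D) := by
      rw [one_div, inv_pow] at hM
      rw [div_eq_mul_inv]
      nlinarith
    have h2 : 0 ≤ 2 * r * √d / √D * ((2 * M + 10) / 2 ^ M) := by positivity
    have h3 : 21 * r * √d / √D = 2 * r * √d / √D * 10 + r * (√d / √D) := by ring
    rw [h3]
    linarith

/-! ### The median and the measurability of a split -/

/-- Order statistics are determined by counting: this gives both their measurability and their
tail bounds. -/
theorem getD_sort_le_iff {m : Multiset ℝ} {i : ℕ} (hi : i < Multiset.card m) (a : ℝ) :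
    (m.sort (· ≤ ·)).getD i 0 ≤ a ↔ i < m.countP (· ≤ a) := by
  set l := m.sort (· ≤ ·) with hl
  have hlen : l.length = Multiset.card m := Multiset.length_sort (· ≤ ·)
  have hs : l.Pairwise (· ≤ ·) := Multiset.pairwise_sort _ _
  have hm : m.countP (· ≤ a) = l.countP (· ≤ a) := by
    conv_lhs => rw [← Multiset.sort_eq m (· ≤ ·)]
    rw [Multiset.coe_countP]
  have hil : i < l.length := by omega
  rw [hm, List.getD_eq_getElem _ _ hil]
  constructor
  · intro h
    have h1 : (l.take (i + 1)).countP (· ≤ a) = (l.take (i + 1)).length := by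
      rw [List.countP_eq_length]
      intro y hy
      obtain ⟨j, hj, rfl⟩ := List.mem_iff_getElem.1 hy
      rw [List.length_take] at hj
      rw [List.getElem_take]
      have : l[j] ≤ l[i] := by
        rcases (show j ≤ i by omega).eq_or_lt with rfl | hji
        · exact le_rfl
        · exact List.pairwise_iff_getElem.1 hs j i _ _ hji
      simpa using this.trans h
    have h2 := (List.take_sublist (i + 1) l).countP_le (p := fun y => decide (y ≤ a))
    rw [h1, List.length_take] at h2
    omega
  · intro h
    by_contra! hlt
    have h1 : (l.drop i).countP (· ≤ a) = 0 := by
      rw [List.countP_eq_zero]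
      intro y hy
      obtain ⟨j, hj, rfl⟩ := List.mem_iff_getElem.1 hy
      rw [List.length_drop] at hj
      rw [List.getElem_drop]
      have : l[i] ≤ l[i + j] := by
        rcases Nat.eq_zero_or_pos j with rfl | hj0
        · exact le_rfl
        · exact List.pairwise_iff_getElem.1 hs i (i + j) _ _ (by omega)
      simpa using hlt.trans_le this
    have h2 : l.countP (· ≤ a) = (l.take i).countP (· ≤ a) + (l.drop i).countP (· ≤ a) := by
      rw [← List.countP_append, List.take_append_drop]
    have h3 := List.countP_le_length (p := fun y => decide (y ≤ a)) (l := l.take i)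
    rw [List.length_take] at h3
    omega

theorem countP_map_val {ι : Type*} (T : Finset ι) (f : ι → ℝ) (a : ℝ) :
    (T.val.map f).countP (· ≤ a) = (T.filter fun z => f z ≤ a).card := by
  rw [Multiset.countP_map]
  rfl

theorem measurable_getD_sort {ι Ω : Type*} [MeasurableSpace Ω] (T : Finset ι) {f : ι → Ω → ℝ}
    (hf : ∀ z, Measurable (f z)) (i : ℕ) :
    Measurable fun ω => ((T.val.map fun z => f z ω).sort (· ≤ ·)).getD i 0 := by
  by_cases hi : i < T.card
  · refine measurable_of_Iic fun a => ?_
    have : (fun ω => ((T.val.map fun z => f z ω).sort (· ≤ ·)).getD i 0) ⁻¹' Set.Iic a =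
        {ω | i < ∑ z ∈ T, if f z ω ≤ a then 1 else 0} := by
      ext ω
      rw [Set.mem_preimage, Set.mem_Iic, getD_sort_le_iff (by simpa using hi), countP_map_val,
        Finset.card_filter]
      rfl
    rw [this]
    refine measurableSet_lt measurable_const (Finset.measurable_fun_sum _ fun z _ => ?_)
    exact Measurable.ite (measurableSet_le (hf z) measurable_const) measurable_const
      measurable_const
  · have (ω : Ω) : ((T.val.map fun z => f z ω).sort (· ≤ ·)).getD i 0 = 0 :=
      List.getD_eq_default _ _ (by simpa using hi)
    simp only [this]
    exact measurable_const

theorem measurable_median {ι Ω : Type*} [MeasurableSpace Ω] (T : Finset ι) {f : ι → Ω → ℝ}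
    (hf : ∀ z, Measurable (f z)) : Measurable fun ω => median (T.val.map fun z => f z ω) := by
  unfold median
  simp only [Multiset.card_map]
  exact ((measurable_getD_sort T hf _).add (measurable_getD_sort T hf _)).div_const _

/-- If the median is far from `β`, then so are at least half of the values. -/
theorem card_le_of_lt_abs_median_sub {ι : Type*} {T : Finset ι} (hT : T.Nonempty) (f : ι → ℝ)
    {β t : ℝ} (h : t < |median (T.val.map f) - β|) :
    T.card ≤ 2 * (T.filter fun z => t < |f z - β|).card := by
  have hn := hT.card_pos
  have hsub {P Q : ι → Prop} [DecidablePred P] [DecidablePred Q] (hPQ : ∀ z, P z → Q z) :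
      (T.filter P).card ≤ (T.filter Q).card :=
    Finset.card_le_card (Finset.monotone_filter_right T fun z _ => hPQ z)
  have hi1 : (T.card - 1) / 2 < Multiset.card (T.val.map f) := by
    rw [Multiset.card_map]; change _ < T.card; omega
  have hi2 : T.card / 2 < Multiset.card (T.val.map f) := by
    rw [Multiset.card_map]; change _ < T.card; omega
  have hle : ((T.val.map f).sort (· ≤ ·)).getD ((T.card - 1) / 2) 0 ≤
      ((T.val.map f).sort (· ≤ ·)).getD (T.card / 2) 0 := by
    rw [getD_sort_le_iff hi1]
    have := (getD_sort_le_iff hi2 _).1 le_rfl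
    omega
  unfold median at h
  rw [Multiset.card_map, show Multiset.card T.val = T.card from rfl] at h
  set y₁ := ((T.val.map f).sort (· ≤ ·)).getD ((T.card - 1) / 2) 0 with hy₁
  set y₂ := ((T.val.map f).sort (· ≤ ·)).getD (T.card / 2) 0 with hy₂
  rcases lt_abs.1 h with h | h
  · have h1 : ¬ y₂ ≤ β + t := by linarith
    rw [hy₂, getD_sort_le_iff hi2, countP_map_val] at h1
    have h2 := Finset.card_filter_add_card_filter_not (s := T) (fun z => f z ≤ β + t)
    have h3 : (T.filter fun z => ¬ f z ≤ β + t).card ≤ (T.filter fun z => t < |f z - β|).card :=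
      hsub fun z hz => lt_abs.2 (Or.inl (by linarith))
    omega
  · have h1 := (getD_sort_le_iff hi1 y₁).1 le_rfl
    rw [countP_map_val] at h1
    have h3 : (T.filter fun z => f z ≤ y₁).card ≤ (T.filter fun z => t < |f z - β|).card :=
      hsub fun z hz => lt_abs.2 (Or.inr (by linarith))
    omega

theorem measurable_threshold {D : ℕ} (x : Pt D) (T : Finset (Pt D)) :
    Measurable (threshold x T) := by
  unfold threshold
  have := measurable_median T (f := fun z (ξ : Choice D) => inner ℝ z ξ.1) (by fun_prop)
  fun_prop

theorem child_subset {D : ℕ} (x : Pt D) (T : Finset (Pt D)) (ξ : Choice D) (b : Bool) :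
    child x T ξ b ⊆ T := by
  cases b <;> exact Finset.filter_subset _ _

theorem measurableSet_child_eq {D : ℕ} (x : Pt D) (T T' : Finset (Pt D)) (b : Bool) :
    MeasurableSet {ξ | child x T ξ b = T'} := by
  classical
  have hside (z : Pt D) : MeasurableSet {ξ : Choice D | inner ℝ z ξ.1 < threshold x T ξ} :=
    measurableSet_lt (by fun_prop) (measurable_threshold x T)
  have hmem (z : Pt D) : MeasurableSet {ξ : Choice D | z ∈ child x T ξ b} := by
    by_cases hz : z ∈ T
    · cases b
      · simpa [child, hz] using hside z
      · have : {ξ : Choice D | z ∈ child x T ξ true} =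
            {ξ : Choice D | inner ℝ z ξ.1 < threshold x T ξ}ᶜ := by
          ext ξ
          simp [child, hz]
        rw [this]
        exact (hside z).compl
    · have : {ξ : Choice D | z ∈ child x T ξ b} = ∅ := by
        ext ξ
        simpa using fun h => hz (child_subset x T ξ b h)
      simp [this]
  by_cases hT' : T' ⊆ T
  · have : {ξ : Choice D | child x T ξ b = T'} =
        ⋂ z ∈ T, {ξ : Choice D | z ∈ child x T ξ b ↔ z ∈ T'} := by
      ext ξ
      simp only [Set.mem_ofPred_eq, Set.mem_iInter]
      refine ⟨fun h z _ => by rw [h], fun h => ?_⟩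
      ext z
      by_cases hz : z ∈ T
      · exact h z hz
      · exact ⟨fun h => absurd (child_subset x T ξ b h) hz, fun h => absurd (hT' h) hz⟩
    rw [this]
    refine Finset.measurableSet_biInter _ fun z _ => ?_
    by_cases hz : z ∈ T'
    · simpa [hz] using hmem z
    · simp only [hz, iff_false]
      exact (hmem z).compl
  · have : {ξ : Choice D | child x T ξ b = T'} = ∅ := by
      ext ξ
      simpa using fun h : child x T ξ b = T' => hT' (h ▸ child_subset x T ξ b)
    simp [this]

/-- No measurability of `F` is needed, since the child takes finitely many values. -/
theorem measurable_comp_child {D : ℕ} {α : Type*} [MeasurableSpace α] (x : Pt D)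
    (T : Finset (Pt D)) (b : Bool) (F : Finset (Pt D) → α) :
    Measurable fun ξ => F (child x T ξ b) := by
  intro s _
  have : (fun ξ => F (child x T ξ b)) ⁻¹' s =
      ⋃ T' ∈ T.powerset, {ξ | child x T ξ b = T' ∧ F T' ∈ s} := by
    ext ξ
    simp only [Set.mem_preimage, Finset.mem_powerset, Set.mem_iUnion, Set.mem_ofPred_eq]
    exact ⟨fun h => ⟨_, child_subset x T ξ b, rfl, h⟩, fun ⟨T', _, h, h'⟩ => h ▸ h'⟩
  rw [this]
  refine Finset.measurableSet_biUnion _ fun T' _ => ?_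
  exact (measurableSet_child_eq x T T' b).inter (MeasurableSet.const _)

theorem measurable_comp_child_add {D : ℕ} (x : Pt D) (T : Finset (Pt D))
    (F : Finset (Pt D) → ℝ≥0∞) :
    Measurable fun ξ => F (child x T ξ false) + F (child x T ξ true) :=
  (measurable_comp_child x T false F).add (measurable_comp_child x T true F)

theorem norm_sub_le_spread {D : ℕ} (x : Pt D) {T : Finset (Pt D)} {z : Pt D} (hz : z ∈ T) :
    ‖z - x‖ ≤ spread x T := by
  rw [← dist_eq_norm, dist_comm, ← coe_nndist, spread, NNReal.coe_le_coe]
  exact Finset.le_sup (f := fun y => nndist x y) hz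

theorem spread_le {D : ℕ} {x : Pt D} {T : Finset (Pt D)} {σ : ℝ} (hσ : 0 ≤ σ)
    (h : ∀ z ∈ T, ‖z - x‖ ≤ σ) : spread x T ≤ σ := by
  lift σ to ℝ≥0 using hσ
  rw [spread, NNReal.coe_le_coe]
  refine Finset.sup_le fun z hz => ?_
  rw [← NNReal.coe_le_coe, coe_nndist, dist_comm, dist_eq_norm]
  exact h z hz

theorem offsetLaw_apply (s : Set ℝ) :
    offsetLaw s = 2⁻¹ * volume (Set.Icc (-1) 1 ∩ s) := by
  rw [offsetLaw, cond_apply measurableSet_Icc, Real.volume_Icc]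
  norm_num

theorem offsetLaw_Icc_le (a b : ℝ) : offsetLaw (Set.Icc a b) ≤ ENNReal.ofReal ((b - a) / 2) := by
  rw [offsetLaw_apply, div_eq_inv_mul, ENNReal.ofReal_mul (by norm_num),
    ENNReal.ofReal_inv_of_pos (by norm_num), ENNReal.ofReal_ofNat, ← Real.volume_Icc]
  gcongr
  exact Set.inter_subset_right

theorem offsetLaw_Ioc {a b : ℝ} (ha : -1 ≤ a) (hb : b ≤ 1) :
    offsetLaw (Set.Ioc a b) = ENNReal.ofReal ((b - a) / 2) := by
  rw [offsetLaw_apply, div_eq_inv_mul, ENNReal.ofReal_mul (by norm_num),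
    ENNReal.ofReal_inv_of_pos (by norm_num), ENNReal.ofReal_ofNat, ← Real.volume_Ioc,
    Set.inter_eq_right.2]
  exact fun y hy => ⟨by linarith [hy.1], by linarith [hy.2]⟩

/-! ### Splitting in a fixed direction -/

open Classical in
/-- The indicator of the event that a cell with data `T` meets both `B` and `B'`. -/
noncomputable def meet {D : ℕ} (B B' : Set (Pt D)) (T : Finset (Pt D)) : ℝ≥0∞ :=
  if (∃ z ∈ T, z ∈ B) ∧ ∃ z ∈ T, z ∈ B' then 1 else 0

theorem meet_mono {D : ℕ} (B B' : Set (Pt D)) {T T' : Finset (Pt D)} (h : T ⊆ T') :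
    meet B B' T ≤ meet B B' T' := by
  unfold meet
  split_ifs with h1 h2
  · exact le_rfl
  · exact absurd ⟨h1.1.imp fun z hz => ⟨h hz.1, hz.2⟩, h1.2.imp fun z hz => ⟨h hz.1, hz.2⟩⟩ h2
  · exact zero_le
  · exact le_rfl

theorem meet_le_one {D : ℕ} (B B' : Set (Pt D)) (T : Finset (Pt D)) : meet B B' T ≤ 1 := by
  unfold meet
  split_ifs <;> simp

/-- A split separates `b` from `b'` unless a child meets both `B` and `B'`, and both children meet
both only if `B` or `B'` is cut, in which case the threshold is close to the projection of `b` or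
of `b'`. Here `m` is the median, `h` the largest offset, and `g`, `g'` bound the widths of the
projections of `B` and `B'`. -/
theorem meet_child_add_le {D : ℕ} {B B' : Set (Pt D)} {x : Pt D} {T : Finset (Pt D)}
    {b b' v : Pt D} {u m h g g' : ℝ} (hh : 0 < h) (hθ : threshold x T (v, u) = m + u * h)
    (hg : ∀ z ∈ T, z ∈ B → |inner ℝ (z - b) v| ≤ g)
    (hg' : ∀ z ∈ T, z ∈ B' → |inner ℝ (z - b') v| ≤ g') :
    meet B B' (child x T (v, u) false) + meet B B' (child x T (v, u) true) +
      (Set.Ioc ((min (inner ℝ b v) (inner ℝ b' v) - m) / h)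
        ((max (inner ℝ b v) (inner ℝ b' v) - m) / h)).indicator 1 u ≤
    1 + (Set.Icc ((inner ℝ b v - m) / h - g / h) ((inner ℝ b v - m) / h + g / h)).indicator 1 u +
      (Set.Icc ((inner ℝ b' v - m) / h - g' / h) ((inner ℝ b' v - m) / h + g' / h)).indicator 1 u
    := by
  have hside (z : Pt D) (b : Pt D) (g : ℝ) (hz : |inner ℝ (z - b) v| ≤ g)
      (hu : u ∉ Set.Icc ((inner ℝ b v - m) / h - g / h) ((inner ℝ b v - m) / h + g / h)) :
      (inner ℝ z v < m + u * h ↔ inner ℝ b v < m + u * h) := by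
    rw [inner_sub_left, abs_le] at hz
    rw [Set.mem_Icc, not_and_or, not_le, not_le, ← sub_div, ← add_div, lt_div_iff₀ hh,
      div_lt_iff₀ hh] at hu
    constructor <;> intro h1 <;> rcases hu with hu | hu <;> linarith
  have hsep : u ∈ Set.Ioc ((min (inner ℝ b v) (inner ℝ b' v) - m) / h)
      ((max (inner ℝ b v) (inner ℝ b' v) - m) / h) →
      ¬ (inner ℝ b v < m + u * h ↔ inner ℝ b' v < m + u * h) := by
    rintro ⟨h1, h2⟩
    rw [div_lt_iff₀ hh] at h1
    rw [le_div_iff₀ hh] at h2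
    have h1 : min (inner ℝ b v) (inner ℝ b' v) < m + u * h := by linarith
    have h2 : m + u * h ≤ max (inner ℝ b v) (inner ℝ b' v) := by linarith
    rw [min_lt_iff] at h1
    rw [le_max_iff] at h2
    intro hiff
    have hboth : inner ℝ b v < m + u * h ∧ inner ℝ b' v < m + u * h := by tauto
    rcases h2 with h2 | h2 <;> linarith [hboth.1, hboth.2]
  have hL (C : Set (Pt D)) : (∃ z ∈ child x T (v, u) false, z ∈ C) →
      ∃ z ∈ T, z ∈ C ∧ inner ℝ z v < m + u * h := by
    rintro ⟨z, hz, hzC⟩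
    simp only [child, Finset.mem_filter, hθ] at hz
    exact ⟨z, hz.1, hzC, hz.2⟩
  have hR (C : Set (Pt D)) : (∃ z ∈ child x T (v, u) true, z ∈ C) →
      ∃ z ∈ T, z ∈ C ∧ ¬ inner ℝ z v < m + u * h := by
    rintro ⟨z, hz, hzC⟩
    simp only [child, Finset.mem_filter, hθ] at hz
    exact ⟨z, hz.1, hzC, hz.2⟩
  by_cases hI : u ∈ Set.Icc ((inner ℝ b v - m) / h - g / h) ((inner ℝ b v - m) / h + g / h)
  · by_cases hI' : u ∈ Set.Icc ((inner ℝ b' v - m) / h - g' / h) ((inner ℝ b' v - m) / h + g' / h)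
    · rw [Set.indicator_of_mem hI, Set.indicator_of_mem hI']
      exact add_le_add (add_le_add (meet_le_one ..) (meet_le_one ..))
        (Set.indicator_le_self _ 1 u)
    · rw [Set.indicator_of_mem hI, Set.indicator_of_notMem hI', add_zero]
      refine add_le_add ?_ (Set.indicator_le_self _ 1 u)
      have hB' : ∀ z ∈ T, z ∈ B' → (inner ℝ z v < m + u * h ↔ inner ℝ b' v < m + u * h) :=
        fun z hzT hz => hside z b' g' (hg' z hzT hz) hI'
      by_cases hb'v : inner ℝ b' v < m + u * h
      · have : meet B B' (child x T (v, u) true) = 0 := by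
          refine if_neg fun hm => ?_
          obtain ⟨z, hzT, hz, h1⟩ := hR _ hm.2
          exact h1 ((hB' z hzT hz).2 hb'v)
        rw [this, add_zero]
        exact meet_le_one ..
      · have : meet B B' (child x T (v, u) false) = 0 := by
          refine if_neg fun hm => ?_
          obtain ⟨z, hzT, hz, h1⟩ := hL _ hm.2
          exact hb'v ((hB' z hzT hz).1 h1)
        rw [this, zero_add]
        exact meet_le_one ..
  · have hB : ∀ z ∈ T, z ∈ B → (inner ℝ z v < m + u * h ↔ inner ℝ b v < m + u * h) :=
      fun z hzT hz => hside z b g (hg z hzT hz) hI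
    have hone : meet B B' (child x T (v, u) false) + meet B B' (child x T (v, u) true) ≤ 1 := by
      by_cases hbv : inner ℝ b v < m + u * h
      · have : meet B B' (child x T (v, u) true) = 0 := by
          refine if_neg fun hm => ?_
          obtain ⟨z, hzT, hz, h1⟩ := hR _ hm.1
          exact h1 ((hB z hzT hz).2 hbv)
        rw [this, add_zero]
        exact meet_le_one ..
      · have : meet B B' (child x T (v, u) false) = 0 := by
          refine if_neg fun hm => ?_
          obtain ⟨z, hzT, hz, h1⟩ := hL _ hm.1
          exact hbv ((hB z hzT hz).1 h1)
        rw [this, zero_add]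
        exact meet_le_one ..
    by_cases hI' : u ∈ Set.Icc ((inner ℝ b' v - m) / h - g' / h) ((inner ℝ b' v - m) / h + g' / h)
    · rw [Set.indicator_of_notMem hI, Set.indicator_of_mem hI', add_zero]
      exact add_le_add hone (Set.indicator_le_self _ 1 u)
    · rw [Set.indicator_of_notMem hI, Set.indicator_of_notMem hI', add_zero, add_zero]
      have hB' : ∀ z ∈ T, z ∈ B' → (inner ℝ z v < m + u * h ↔ inner ℝ b' v < m + u * h) :=
        fun z hzT hz => hside z b' g' (hg' z hzT hz) hI'
      by_cases hs : u ∈ Set.Ioc ((min (inner ℝ b v) (inner ℝ b' v) - m) / h)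
          ((max (inner ℝ b v) (inner ℝ b' v) - m) / h)
      · have h1 : meet B B' (child x T (v, u) true) = 0 := by
          refine if_neg fun hm => ?_
          obtain ⟨z, hzT, hz, h1⟩ := hR _ hm.1
          obtain ⟨z', hzT', hz', h1'⟩ := hR _ hm.2
          have := hsep hs
          rw [← hB z hzT hz, ← hB' z' hzT' hz'] at this
          tauto
        have h2 : meet B B' (child x T (v, u) false) = 0 := by
          refine if_neg fun hm => ?_
          obtain ⟨z, hzT, hz, h1⟩ := hL _ hm.1
          obtain ⟨z', hzT', hz', h1'⟩ := hL _ hm.2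
          have := hsep hs
          rw [← hB z hzT hz, ← hB' z' hzT' hz'] at this
          tauto
        rw [h1, h2, add_zero, zero_add]
        exact Set.indicator_le_self _ 1 u
      · rw [Set.indicator_of_notMem hs, add_zero]
        exact hone

/-- For a fixed direction, the expected number of children that meet both `B` and `B'`. Here `q` is
a lower bound of the probability that the split separates `b` from `b'`, which is
`|⟪b - b', v⟫| / (2 h)` if both projections are within reach of the threshold. -/
theorem lintegral_offset_meet_child_le {D : ℕ} {B B' : Set (Pt D)} {x : Pt D} {T : Finset (Pt D)}
    {b b' v : Pt D} {m h g g' q : ℝ} (hh : 0 < h)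
    (hθ : ∀ u, threshold x T (v, u) = m + u * h)
    (hg0 : 0 ≤ g) (hg0' : 0 ≤ g')
    (hg : ∀ z ∈ T, z ∈ B → |inner ℝ (z - b) v| ≤ g)
    (hg' : ∀ z ∈ T, z ∈ B' → |inner ℝ (z - b') v| ≤ g')
    (hq : q ≤ 0 ∨ |inner ℝ b v - m| ≤ h ∧ |inner ℝ b' v - m| ≤ h ∧
      q ≤ |inner ℝ (b - b') v| / (2 * h)) :
    q ≤ 1 ∧
    ∫⁻ u, (meet B B' (child x T (v, u) false) + meet B B' (child x T (v, u) true)) ∂offsetLaw ≤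
      ENNReal.ofReal (1 - q + (g + g') / h) := by
  set I := Set.Ioc ((min (inner ℝ b v) (inner ℝ b' v) - m) / h)
        ((max (inner ℝ b v) (inner ℝ b' v) - m) / h) with hI
  have hqI : ENNReal.ofReal q ≤ offsetLaw I := by
    rcases hq with hq | ⟨h1, h2, hq⟩
    · simp [ENNReal.ofReal_of_nonpos hq]
    · rw [abs_le] at h1 h2
      rw [hI, offsetLaw_Ioc]
      · apply ENNReal.ofReal_le_ofReal
        refine hq.trans (le_of_eq ?_)
        rw [← sub_div, div_div, mul_comm h 2, inner_sub_left, ← max_sub_min_eq_abs]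
        congr 1
        rw [max_comm, min_comm]
        ring
      · rw [le_div_iff₀ hh]
        have : m - h ≤ min (inner ℝ b v) (inner ℝ b' v) :=
          le_min (by linarith) (by linarith)
        linarith
      · rw [div_le_iff₀ hh]
        have : max (inner ℝ b v) (inner ℝ b' v) ≤ m + h :=
          max_le (by linarith) (by linarith)
        linarith
  have hq1 : q ≤ 1 := by
    have := hqI.trans prob_le_one
    exact ENNReal.ofReal_le_one.1 this
  refine ⟨hq1, ?_⟩
  have hIcc (a g : ℝ) : offsetLaw (Set.Icc (a - g / h) (a + g / h)) ≤ ENNReal.ofReal (g / h) :=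
    (offsetLaw_Icc_le _ _).trans (by rw [show (a + g / h - (a - g / h)) / 2 = g / h by ring])
  have key := lintegral_mono (μ := offsetLaw) fun u =>
    meet_child_add_le hh (hθ u) hg hg'
  rw [lintegral_add_right _ (measurable_one.indicator measurableSet_Ioc),
    lintegral_add_right _ (measurable_one.indicator measurableSet_Icc),
    lintegral_add_right _ (measurable_one.indicator measurableSet_Icc),
    lintegral_indicator_one measurableSet_Ioc, lintegral_indicator_one measurableSet_Icc,
    lintegral_indicator_one measurableSet_Icc, lintegral_one, measure_univ] at key
  have h1 : ∫⁻ u, (meet B B' (child x T (v, u) false) + meet B B' (child x T (v, u) true))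
      ∂offsetLaw + ENNReal.ofReal q ≤ 1 + ENNReal.ofReal (g / h) + ENNReal.ofReal (g' / h) :=
    (add_le_add_right hqI _).trans (key.trans (add_le_add (add_le_add_right (hIcc _ _) _)
      (hIcc _ _)))
  rcases le_total q 0 with hq0 | hq0
  · rw [ENNReal.ofReal_of_nonpos hq0, add_zero] at h1
    refine h1.trans ?_
    rw [← ENNReal.ofReal_one, ← ENNReal.ofReal_add (by norm_num) (by positivity),
      ← ENNReal.ofReal_add (by positivity) (by positivity)]
    apply ENNReal.ofReal_le_ofReal
    rw [add_div]
    linarith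
  · rw [show 1 - q + (g + g') / h = (1 + g / h + g' / h) - q by ring, ENNReal.ofReal_sub _ hq0]
    refine ENNReal.le_sub_of_add_le_right ENNReal.ofReal_ne_top (h1.trans (le_of_eq ?_))
    rw [ENNReal.ofReal_add (by positivity) (by positivity),
      ENNReal.ofReal_add (by positivity) (by positivity), ENNReal.ofReal_one]

/-! ### One random split -/

/-- A polynomial lower bound of `|w|`, so that its expectation is controlled by moments. -/
theorem quartic_le_abs (w : ℝ) : 3 / 5 * (w ^ 2 - w ^ 4 / 18) ≤ |w| := by
  have h : 0 ≤ |w| := abs_nonneg w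
  rw [← sq_abs, show w ^ 4 = |w| ^ 4 by rw [← abs_pow, abs_of_nonneg (by positivity)]]
  set y := |w|
  -- `2.45` is close to the double root `√6` of the optimal cubic
  have h1 : 0 ≤ (y - 2.45) ^ 2 * (y + 2 * 2.45) := by positivity
  have h2 : 0 ≤ y * (y ^ 3 - 18 * y + 30) := mul_nonneg h (by nlinarith)
  nlinarith

/-- A polynomial in `v` that is at least `1` if the projection of `b` or of `b'` is at distance more
than `2 t` from the median. The sum over `T` controls the distance from the median to the projection
of `x`, as at least half of the data are as far from the latter as the median. -/
noncomputable def farness {D : ℕ} (x b b' : Pt D) (T : Finset (Pt D)) (t : ℝ) (v : Pt D) : ℝ :=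
  (inner ℝ (b - x) v ^ 4 + inner ℝ (b' - x) v ^ 4 +
    2 / T.card * ∑ z ∈ T, inner ℝ (z - x) v ^ 4) / t ^ 4

theorem farness_nonneg {D : ℕ} (x b b' : Pt D) (T : Finset (Pt D)) (t : ℝ) (v : Pt D) :
    0 ≤ farness x b b' T t v := by
  unfold farness
  have : 0 ≤ ∑ z ∈ T, inner ℝ (z - x) v ^ 4 := Finset.sum_nonneg fun z _ => by positivity
  positivity

theorem abs_inner_sub_median_le {D : ℕ} {x b b' : Pt D} {T : Finset (Pt D)} (hT : T.Nonempty)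
    {t : ℝ} (ht : 0 < t) {v : Pt D} (hf : farness x b b' T t v < 1) :
    |inner ℝ b v - median (T.val.map fun z => inner ℝ z v)| ≤ 2 * t ∧
    |inner ℝ b' v - median (T.val.map fun z => inner ℝ z v)| ≤ 2 * t := by
  set m := median (T.val.map fun z => inner ℝ z v) with hm
  have hsum : 0 ≤ ∑ z ∈ T, inner ℝ (z - x) v ^ 4 := Finset.sum_nonneg fun z _ => by positivity
  have h2 : 0 ≤ 2 / (T.card : ℝ) * ∑ z ∈ T, inner ℝ (z - x) v ^ 4 := by positivity
  have ht4 : 0 < t ^ 4 := by positivity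
  rw [farness, div_lt_one ht4] at hf
  have hpow (a : ℝ) (ha : a ^ 4 < t ^ 4) : |a| ≤ t := by
    by_contra! h
    have := pow_lt_pow_left₀ h ht.le (n := 4) (by norm_num)
    rw [← abs_pow, abs_of_nonneg (a := a ^ 4) (by positivity)] at this
    linarith
  have hb : |inner ℝ (b - x) v| ≤ t := hpow _ (by
    have : 0 ≤ inner ℝ (b' - x) v ^ 4 := by positivity
    linarith)
  have hb' : |inner ℝ (b' - x) v| ≤ t := hpow _ (by
    have : 0 ≤ inner ℝ (b - x) v ^ 4 := by positivity
    linarith)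
  have hmed : |m - inner ℝ x v| ≤ t := by
    by_contra! h
    have hcard := card_le_of_lt_abs_median_sub hT (fun z => inner ℝ z v) h
    have hn : (0 : ℝ) < T.card := by exact_mod_cast hT.card_pos
    have h3 : (T.filter fun z => t < |inner ℝ z v - inner ℝ x v|).card • t ^ 4 ≤
        ∑ z ∈ T, inner ℝ (z - x) v ^ 4 := by
      refine le_trans (Finset.card_nsmul_le_sum (T.filter fun z => t < |inner ℝ z v - inner ℝ x v|)
        (fun z => inner ℝ (z - x) v ^ 4) _ fun z hz => ?_)
        (Finset.sum_le_sum_of_subset_of_nonneg (Finset.filter_subset _ _)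
          fun z _ _ => by positivity)
      have := (Finset.mem_filter.1 hz).2
      rw [← inner_sub_left] at this
      by_contra! hlt
      exact absurd (hpow _ hlt) (by linarith)
    rw [nsmul_eq_mul] at h3
    have h4 : (T.card : ℝ) ≤
        2 * ((T.filter fun z => t < |inner ℝ z v - inner ℝ x v|).card : ℝ) := by
      exact_mod_cast hcard
    have h5 : t ^ 4 ≤ 2 / (T.card : ℝ) * ∑ z ∈ T, inner ℝ (z - x) v ^ 4 := by
      rw [div_mul_eq_mul_div, le_div_iff₀ hn]
      nlinarith
    have h6 : 0 ≤ inner ℝ (b' - x) v ^ 4 := by positivity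
    have h7 : 0 ≤ inner ℝ (b - x) v ^ 4 := by positivity
    linarith
  rw [inner_sub_left] at hb hb'
  rw [abs_le] at hb hb' hmed
  refine ⟨abs_le.2 ⟨?_, ?_⟩, abs_le.2 ⟨?_, ?_⟩⟩ <;>
    linarith [hb.1, hb.2, hb'.1, hb'.2, hmed.1, hmed.2]

theorem integral_farness_le {D : ℕ} [NeZero D] {x b b' : Pt D} {T : Finset (Pt D)} {σ : ℝ}
    (hσ : 0 < σ) (hb : b ∈ T) (hb' : b' ∈ T) (hT : ∀ z ∈ T, ‖z - x‖ ≤ σ) :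
    ∫ v, farness x b b' T (3 * σ / √D) v ∂directionLaw D ≤ 4 / 27 := by
  have hD : (0 : ℝ) < D := by exact_mod_cast NeZero.pos D
  have hn : (0 : ℝ) < T.card := by exact_mod_cast Finset.card_pos.2 ⟨b, hb⟩
  have h (z : Pt D) (hz : z ∈ T) :
      ∫ v, inner ℝ (z - x) v ^ 4 ∂directionLaw D ≤ 3 * σ ^ 4 / D ^ 2 := by
    refine (integral_pow_four_inner_le _).trans ?_
    have := hT z hz
    gcongr
  have hi (w : Pt D) : Integrable (fun v => inner ℝ w v ^ 4) (directionLaw D) :=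
    integrable_directionLaw (by fun_prop)
  unfold farness
  rw [integral_div, integral_add (integrable_directionLaw (by fun_prop))
    (integrable_directionLaw (by fun_prop)), integral_add (hi _) (hi _), integral_const_mul,
    integral_finsetSum _ fun z _ => hi _, div_le_iff₀ (by positivity)]
  have hs : ∑ z ∈ T, ∫ v, inner ℝ (z - x) v ^ 4 ∂directionLaw D ≤
      T.card * (3 * σ ^ 4 / D ^ 2) := by
    rw [← nsmul_eq_mul]
    exact Finset.sum_le_card_nsmul _ _ _ h
  have hs' : 2 / (T.card : ℝ) * ∑ z ∈ T, ∫ v, inner ℝ (z - x) v ^ 4 ∂directionLaw D ≤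
      2 * (3 * σ ^ 4 / D ^ 2) := by
    rw [div_mul_eq_mul_div, div_le_iff₀ hn]
    linarith
  have ht : (3 * σ / √D) ^ 4 = 81 * σ ^ 4 / D ^ 2 := by
    rw [div_pow, show √(D : ℝ) ^ 4 = (√(D : ℝ) ^ 2) ^ 2 by ring, Real.sq_sqrt hD.le]
    ring
  rw [ht]
  have := h b hb
  have := h b' hb'
  have e1 : 4 / 27 * (81 * σ ^ 4 / (D : ℝ) ^ 2) = 4 * (3 * σ ^ 4 / D ^ 2) := by ring
  linarith

/-- A lower bound, polynomial in `v`, of the probability, given the direction `v`, that the split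
separates `b` from `b'`. -/
noncomputable def sepBound {D : ℕ} (x b b' : Pt D) (T : Finset (Pt D)) (σ : ℝ) (v : Pt D) : ℝ :=
  ‖b - b'‖ / (20 * σ) * (D * inner ℝ (b - b') v ^ 2 / ‖b - b'‖ ^ 2 -
    D ^ 2 * inner ℝ (b - b') v ^ 4 / (6 * ‖b - b'‖ ^ 4) -
    9 / 4 * farness x b b' T (3 * σ / √D) v)

theorem continuous_sepBound {D : ℕ} (x b b' : Pt D) (T : Finset (Pt D)) (σ : ℝ) :
    Continuous (sepBound x b b' T σ) := by
  unfold sepBound farness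
  fun_prop

theorem sepBound_le {D : ℕ} [NeZero D] {x b b' : Pt D} {T : Finset (Pt D)} {σ : ℝ}
    (hσ : 0 < σ) (hb : b ∈ T) (hbb : b ≠ b') (v : Pt D) :
    sepBound x b b' T σ v ≤ 0 ∨
      |inner ℝ b v - median (T.val.map fun z => inner ℝ z v)| ≤ 6 * σ / √D ∧
      |inner ℝ b' v - median (T.val.map fun z => inner ℝ z v)| ≤ 6 * σ / √D ∧
      sepBound x b b' T σ v ≤ |inner ℝ (b - b') v| / (2 * (6 * σ / √D)) := by
  have hD : (0 : ℝ) < D := by exact_mod_cast NeZero.pos D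
  have hρ : 0 < ‖b - b'‖ := norm_sub_pos_iff.2 hbb
  have hf0 := farness_nonneg x b b' T (3 * σ / √D) v
  unfold sepBound
  set ρ := ‖b - b'‖ with hρd
  set a : ℝ := inner ℝ (b - b') v with ha
  set w : ℝ := √D * a / ρ with hw
  have hw2 : D * a ^ 2 / ρ ^ 2 = w ^ 2 := by rw [hw, div_pow, mul_pow, Real.sq_sqrt hD.le]
  have hw4 : D ^ 2 * a ^ 4 / (6 * ρ ^ 4) = w ^ 4 / 6 := by
    rw [show w ^ 4 = (w ^ 2) ^ 2 by ring, ← hw2]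
    field_simp
  rw [hw2, hw4]
  by_cases hf : farness x b b' T (3 * σ / √D) v < 1
  · right
    obtain ⟨h1, h2⟩ := abs_inner_sub_median_le ⟨b, hb⟩ (by positivity) hf
    have e : 2 * (3 * σ / √(D : ℝ)) = 6 * σ / √D := by ring
    rw [e] at h1 h2
    refine ⟨h1, h2, ?_⟩
    have h3 := quartic_le_abs w
    have h4 : |a| / (2 * (6 * σ / √D)) = ρ / (20 * σ) * (5 / 3 * |w|) := by
      rw [hw, abs_div, abs_mul, abs_of_pos hρ, abs_of_nonneg (Real.sqrt_nonneg _)]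
      field_simp
      ring
    rw [h4]
    refine mul_le_mul_of_nonneg_left ?_ (by positivity)
    have : 0 ≤ w ^ 4 := by positivity
    linarith
  · left
    refine mul_nonpos_of_nonneg_of_nonpos (by positivity) ?_
    push Not at hf
    nlinarith [sq_nonneg (w ^ 2 - 3)]

theorem le_integral_sepBound {D : ℕ} [NeZero D] {x b b' : Pt D} {T : Finset (Pt D)} {σ : ℝ}
    (hσ : 0 < σ) (hb : b ∈ T) (hb' : b' ∈ T) (hT : ∀ z ∈ T, ‖z - x‖ ≤ σ) (hbb : b ≠ b') :
    ‖b - b'‖ / (120 * σ) ≤ ∫ v, sepBound x b b' T σ v ∂directionLaw D := by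
  have hD : (0 : ℝ) < D := by exact_mod_cast NeZero.pos D
  have hρ : 0 < ‖b - b'‖ := norm_sub_pos_iff.2 hbb
  have hf := integral_farness_le hσ hb hb' hT
  have hfi : Integrable (farness x b b' T (3 * σ / √D)) (directionLaw D) :=
    integrable_directionLaw (by unfold farness; fun_prop)
  unfold sepBound
  rw [integral_const_mul, integral_sub (integrable_directionLaw (by fun_prop))
    (hfi.const_mul _), integral_sub (integrable_directionLaw (by fun_prop))
    (integrable_directionLaw (by fun_prop)), integral_const_mul, integral_div, integral_div,
    integral_const_mul, integral_const_mul, integral_sq_inner]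
  have h4 := integral_pow_four_inner_le (b - b')
  have e1 : (D : ℝ) * (‖b - b'‖ ^ 2 / D) / ‖b - b'‖ ^ 2 = 1 := by field_simp
  have e2 : (D : ℝ) ^ 2 * (∫ v, inner ℝ (b - b') v ^ 4 ∂directionLaw D) / (6 * ‖b - b'‖ ^ 4) ≤
      1 / 2 := by
    rw [le_div_iff₀ (by positivity)] at h4
    rw [div_le_iff₀ (by positivity)]
    linarith
  rw [e1]
  calc ‖b - b'‖ / (120 * σ) = ‖b - b'‖ / (20 * σ) * (1 / 6) := by field_simp; norm_num
    _ ≤ _ := mul_le_mul_of_nonneg_left (by linarith) (by positivity)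

/-- One split of a cell: if two small balls are far from each other within the cell, then the
expected number of children that meet both is smaller than one, by an amount proportional to the
distance of the balls relative to the diameter of the cell. -/
theorem lintegral_meet_child_le {D d : ℕ} [NeZero D] {T : Finset (Pt D)} {x : Pt D}
    (hx : T.Nonempty → x ∈ T) (hT : IsDoubling (T : Set (Pt D)) d) (hd : 1 ≤ d)
    {c c' : Pt D} {r ρ Δ : ℝ} (hr : 0 < r) (hρ : 1680 * (r * √d) ≤ ρ)
    (hfar : ∀ z ∈ Metric.closedBall c r, ∀ z' ∈ Metric.closedBall c' r, ρ ≤ ‖z - z'‖)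
    (hΔ : 0 < Δ) (hdiam : ∀ z ∈ T, ∀ z' ∈ T, ‖z - z'‖ ≤ Δ) :
    ∫⁻ ξ, (meet (Metric.closedBall c r) (Metric.closedBall c' r) (child x T ξ false) +
        meet (Metric.closedBall c r) (Metric.closedBall c' r) (child x T ξ true))
        ∂(directionLaw D).prod offsetLaw ≤
      ENNReal.ofReal (1 - ρ / (240 * Δ)) *
        meet (Metric.closedBall c r) (Metric.closedBall c' r) T := by
  set B := Metric.closedBall c r
  set B' := Metric.closedBall c' r
  have hD : (0 : ℝ) < D := by exact_mod_cast NeZero.pos D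
  have hd0 : (0 : ℝ) < d := by exact_mod_cast hd
  by_cases hm : (∃ z ∈ T, z ∈ B) ∧ ∃ z ∈ T, z ∈ B'
  swap
  · have h0 (ξ : Choice D) (i : Bool) : meet B B' (child x T ξ i) = 0 := by
      have h1 : meet B B' T = 0 := if_neg hm
      exact le_antisymm (h1 ▸ meet_mono B B' (child_subset x T ξ i)) zero_le
    simp [h0]
  obtain ⟨⟨b, hbT, hb⟩, ⟨b', hbT', hb'⟩⟩ := hm
  have hmT : meet B B' T = 1 := if_pos ⟨⟨b, hbT, hb⟩, ⟨b', hbT', hb'⟩⟩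
  rw [hmT, mul_one]
  have hρ0 : 0 < ρ := lt_of_lt_of_le (by positivity) hρ
  have hbb' : ρ ≤ ‖b - b'‖ := hfar b hb b' hb'
  have hne : b ≠ b' := by rintro rfl; simp at hbb'; linarith
  set σ := spread x T with hσdef
  have hTσ : ∀ z ∈ T, ‖z - x‖ ≤ σ := fun z hz => norm_sub_le_spread x hz
  have hσΔ : σ ≤ Δ := spread_le hΔ.le fun z hz => hdiam z hz x (hx ⟨b, hbT⟩)
  have hσ : 0 < σ := by
    have h1 := norm_sub_le_norm_sub_add_norm_sub b x b'
    rw [norm_sub_rev x b'] at h1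
    linarith [hTσ b hbT, hTσ b' hbT']
  obtain ⟨g, hgc, hg0, hg, hgi⟩ := hT.exists_width_majorant hd hr ⟨hbT, hb⟩
  obtain ⟨g', hgc', hg0', hg', hgi'⟩ := hT.exists_width_majorant hd hr ⟨hbT', hb'⟩
  set h := 6 * σ / √(D : ℝ) with hh
  have hh0 : 0 < h := by positivity
  have key (v : Pt D) := lintegral_offset_meet_child_le (B := B) (B' := B') (x := x) (T := T)
    (b := b) (b' := b') (v := v) (m := median (T.val.map fun z => inner ℝ z v))
    (g := g v) (g' := g' v) hh0 (fun u => rfl) (hg0 v) (hg0' v)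
    (fun z hzT hz => hg v z ⟨hzT, hz⟩) (fun z hzT hz => hg' v z ⟨hzT, hz⟩)
    (sepBound_le (x := x) hσ hbT hne v)
  have hqc := continuous_sepBound x b b' T σ
  refine (lintegral_prod_le _).trans ((lintegral_mono fun v => (key v).2).trans ?_)
  rw [← ofReal_integral_eq_lintegral_ofReal (integrable_directionLaw (by fun_prop))
    (Filter.Eventually.of_forall fun v => by
      have := (key v).1
      have := hg0 v
      have := hg0' v
      have : 0 ≤ (g v + g' v) / h := by positivity
      simp only [Pi.zero_apply]
      linarith)]
  apply ENNReal.ofReal_le_ofReal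
  rw [integral_add (integrable_directionLaw (by fun_prop)) (integrable_directionLaw (by fun_prop)),
    integral_sub (integrable_const _) (integrable_directionLaw hqc), integral_div,
    integral_add (integrable_directionLaw hgc) (integrable_directionLaw hgc')]
  have h1 := le_integral_sepBound hσ hbT hbT' hTσ hne
  have h2 : ‖b - b'‖ / (120 * σ) ≥ ρ / (120 * σ) := by gcongr
  have h3 : (∫ v, g v ∂directionLaw D + ∫ v, g' v ∂directionLaw D) / h ≤ ρ / (240 * σ) := by
    rw [div_le_iff₀ hh0]
    have e : ρ / (240 * σ) * h = ρ / 40 / √D := by rw [hh]; field_simp; norm_num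
    have e2 : 21 * r * √d / √D + 21 * r * √d / √D ≤ ρ / 40 / √D := by
      rw [← add_div]
      gcongr
      linarith
    linarith
  have h4 : ρ / (240 * Δ) ≤ ρ / (240 * σ) := by gcongr
  have h5 : ρ / (120 * σ) = ρ / (240 * σ) + ρ / (240 * σ) := by field_simp; norm_num
  simp only [integral_const, probReal_univ, smul_eq_mul, mul_one]
  linarith

/-! ### First-step analysis of the tree -/

/-- The data of the cell at `q ++ p` if the cell at `p` has data `T`. -/
noncomputable def desc {D : ℕ} (pick : Node → Finset (Pt D) → Pt D) (p : Node)
    (T : Finset (Pt D)) (ω : Node → Choice D) : Node → Finset (Pt D)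
  | [] => T
  | b :: q => child (pick (q ++ p) (desc pick p T ω q)) (desc pick p T ω q) (ω (q ++ p)) b

theorem cell_resample_of_suffix {D : ℕ} (pick : Node → Finset (Pt D) → Pt D) (S : Finset (Pt D))
    (ω₀ ω : Node → Choice D) {p : Node} :
    ∀ a : Node, a <:+ p → cell pick S (resample p ω₀ ω) a = cell pick S ω₀ a
  | [], _ => rfl
  | b :: a, h => by
    have ha : a <:+ p := (List.suffix_cons b a).trans h
    have hn : ¬ p <:+ a := fun hp => by
      have h1 := h.length_le
      have h2 := hp.length_le
      rw [List.length_cons] at h1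
      omega
    simp only [cell, cell_resample_of_suffix pick S ω₀ ω a ha, resample, hn, if_false]

theorem cell_resample_append {D : ℕ} (pick : Node → Finset (Pt D) → Pt D) (S : Finset (Pt D))
    (ω₀ ω : Node → Choice D) (p : Node) :
    ∀ q : Node, cell pick S (resample p ω₀ ω) (q ++ p) = desc pick p (cell pick S ω₀ p) ω q
  | [] => cell_resample_of_suffix pick S ω₀ ω p List.suffix_rfl
  | b :: q => by
    have h : p <:+ q ++ p := List.suffix_append q p
    simp only [List.cons_append, cell, desc, cell_resample_append pick S ω₀ ω p q, resample, h,
      if_true]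

theorem desc_append_singleton {D : ℕ} (pick : Node → Finset (Pt D) → Pt D) (p : Node)
    (T : Finset (Pt D)) (ω : Node → Choice D) (b : Bool) :
    ∀ q : Node, desc pick p T ω (q ++ [b]) =
      desc pick (b :: p) (child (pick p T) T (ω p) b) ω q
  | [] => rfl
  | c :: q => by
    simp only [List.cons_append, desc, desc_append_singleton pick p T ω b q, List.append_assoc,
      List.nil_append]

theorem desc_append_subset {D : ℕ} (pick : Node → Finset (Pt D) → Pt D) (p : Node)
    (T : Finset (Pt D)) (ω : Node → Choice D) (q : Node) :
    ∀ q' : Node, desc pick p T ω (q' ++ q) ⊆ desc pick p T ω q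
  | [] => subset_rfl
  | _ :: q' => (child_subset _ _ _ _).trans (desc_append_subset pick p T ω q q')

/-- The event that some descendant, `k` levels below, of the node `p`, whose cell has data `T`, has
a cell with `bad` data. -/
def failSet {D : ℕ} (pick : Node → Finset (Pt D) → Pt D) (bad : Finset (Pt D) → Prop) (k : ℕ)
    (p : Node) (T : Finset (Pt D)) : Set (Node → Choice D) :=
  {ω | ∃ q : Node, q.length = k ∧ bad (desc pick p T ω q)}

theorem failSet_succ {D : ℕ} (pick : Node → Finset (Pt D) → Pt D) (bad : Finset (Pt D) → Prop)
    (k : ℕ) (p : Node) (T : Finset (Pt D)) :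
    failSet pick bad (k + 1) p T = ⋃ b : Bool, ⋃ T' ∈ T.powerset,
      (fun ω => ω p) ⁻¹' {ξ | child (pick p T) T ξ b = T'} ∩ failSet pick bad k (b :: p) T' := by
  ext ω
  simp only [Set.mem_iUnion, Set.mem_inter_iff, Set.mem_preimage, Finset.mem_powerset, failSet,
    Set.mem_ofPred_eq]
  constructor
  · rintro ⟨q, hq, hbad⟩
    obtain ⟨q', b, rfl⟩ : ∃ q' b, q = q' ++ [b] := by
      rcases List.eq_nil_or_concat q with rfl | ⟨q', b, rfl⟩
      · simp at hq
      · exact ⟨q', b, by simp⟩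
    rw [desc_append_singleton] at hbad
    exact ⟨b, _, child_subset _ _ _ _, rfl, q', by simpa using hq, hbad⟩
  · rintro ⟨b, T', _, rfl, q, hq, hbad⟩
    exact ⟨q ++ [b], by simp [hq], by rwa [desc_append_singleton]⟩

/-- The event `failSet` is determined by the choices at `p` and its descendants. -/
theorem measurableSet_iSup_comap_failSet {D : ℕ} (pick : Node → Finset (Pt D) → Pt D)
    (bad : Finset (Pt D) → Prop) (k : ℕ) (p : Node) (T : Finset (Pt D)) :
    MeasurableSet[⨆ a ∈ {a : Node | p <:+ a},
      MeasurableSpace.comap (fun ω : Node → Choice D => ω a) inferInstance]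
      (failSet pick bad k p T) := by
  induction k generalizing p T with
  | zero =>
    have : failSet pick bad 0 p T = {_ω | bad T} := by
      ext ω
      simp [failSet, desc]
    rw [this]
    exact MeasurableSet.const _
  | succ k ih =>
    rw [failSet_succ]
    refine MeasurableSet.iUnion fun b => Finset.measurableSet_biUnion _ fun T' _ => ?_
    refine MeasurableSet.inter ?_ ?_
    · refine (le_iSup₂_of_le (f := fun (a : Node) (_ : a ∈ {a : Node | p <:+ a}) =>
        MeasurableSpace.comap (fun ω : Node → Choice D => ω a) inferInstance)
        p List.suffix_rfl le_rfl) _ ?_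
      exact ⟨_, measurableSet_child_eq _ _ _ _, rfl⟩
    · have hle : (⨆ a ∈ {a : Node | (b :: p) <:+ a},
          MeasurableSpace.comap (fun ω : Node → Choice D => ω a) inferInstance) ≤
          ⨆ a ∈ {a : Node | p <:+ a},
            MeasurableSpace.comap (fun ω : Node → Choice D => ω a) inferInstance :=
        biSup_mono fun a ha => (List.suffix_cons b p).trans ha
      exact hle _ (ih _ _)

theorem measurableSet_failSet {D : ℕ} (pick : Node → Finset (Pt D) → Pt D)
    (bad : Finset (Pt D) → Prop) (k : ℕ) (p : Node) (T : Finset (Pt D)) :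
    MeasurableSet (failSet pick bad k p T) :=
  (iSup₂_le fun a _ => (measurable_pi_apply a).comap_le :
    (⨆ a ∈ {a : Node | p <:+ a},
      MeasurableSpace.comap (fun ω : Node → Choice D => ω a) inferInstance) ≤ MeasurableSpace.pi) _
    (measurableSet_iSup_comap_failSet pick bad k p T)

/-- The choices at a node are independent of the choices below the node. -/
theorem treeLaw_inter_failSet {D : ℕ} [NeZero D] (pick : Node → Finset (Pt D) → Pt D)
    (bad : Finset (Pt D) → Prop) (k : ℕ) (p : Node) (b : Bool) (T : Finset (Pt D))
    {s : Set (Choice D)} (hs : MeasurableSet s) :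
    treeLaw D ((fun ω => ω p) ⁻¹' s ∩ failSet pick bad k (b :: p) T) =
      (directionLaw D).prod offsetLaw s * treeLaw D (failSet pick bad k (b :: p) T) := by
  have hind : iIndepFun (fun (a : Node) (ω : Node → Choice D) => ω a) (treeLaw D) :=
    iIndepFun_infinitePi (P := fun _ : Node => (directionLaw D).prod offsetLaw)
      (X := fun _ ξ => ξ) (fun _ => measurable_id)
  have hdisj : Disjoint {p} {a : Node | (b :: p) <:+ a} := by
    rw [Set.disjoint_singleton_left]
    intro h
    have := List.IsSuffix.length_le h
    simp at this
  have h := indep_iSup_of_disjoint (fun a => (measurable_pi_apply a).comap_le) hind.iIndep hdisj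
  rw [Indep_iff] at h
  rw [h _ _ ?_ (measurableSet_iSup_comap_failSet pick bad k (b :: p) T)]
  · congr 1
    rw [treeLaw, ← Measure.map_apply (measurable_pi_apply p) hs]
    congr 1
    exact (measurePreserving_eval_infinitePi _ p).map_eq
  · rw [iSup_singleton]
    exact ⟨s, hs, rfl⟩

/-- First-step analysis: the probability of failure below a node is at most the expected sum of
those below its children. -/
theorem treeLaw_failSet_succ_le {D : ℕ} [NeZero D] (pick : Node → Finset (Pt D) → Pt D)
    (bad : Finset (Pt D) → Prop) (k : ℕ) (p : Node) (T : Finset (Pt D)) :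
    treeLaw D (failSet pick bad (k + 1) p T) ≤
      ∫⁻ ξ, (treeLaw D (failSet pick bad k (false :: p) (child (pick p T) T ξ false)) +
        treeLaw D (failSet pick bad k (true :: p) (child (pick p T) T ξ true)))
        ∂(directionLaw D).prod offsetLaw := by
  have hb (b : Bool) : treeLaw D (⋃ T' ∈ T.powerset,
      (fun ω => ω p) ⁻¹' {ξ | child (pick p T) T ξ b = T'} ∩ failSet pick bad k (b :: p) T') ≤
      ∫⁻ ξ, treeLaw D (failSet pick bad k (b :: p) (child (pick p T) T ξ b))
        ∂(directionLaw D).prod offsetLaw := by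
    refine (measure_biUnion_finset_le _ _).trans (le_of_eq ?_)
    simp_rw [treeLaw_inter_failSet pick bad k p b _ (measurableSet_child_eq _ _ _ _)]
    have h (ξ : Choice D) : treeLaw D (failSet pick bad k (b :: p) (child (pick p T) T ξ b)) =
        ∑ T' ∈ T.powerset, {ξ | child (pick p T) T ξ b = T'}.indicator
          (fun _ => treeLaw D (failSet pick bad k (b :: p) T')) ξ := by
      rw [Finset.sum_eq_single (child (pick p T) T ξ b)]
      · simp
      · intro T' _ hne
        exact Set.indicator_of_notMem (fun h => hne h.symm) _
      · intro h
        exact absurd (Finset.mem_powerset.2 (child_subset _ _ _ _)) h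
    simp_rw [h]
    rw [lintegral_finsetSum _ fun T' _ =>
      measurable_const.indicator (measurableSet_child_eq _ _ _ _)]
    refine Finset.sum_congr rfl fun T' _ => ?_
    rw [lintegral_indicator_const (measurableSet_child_eq _ _ _ _), mul_comm]
  rw [failSet_succ]
  refine (measure_iUnion_le _).trans ?_
  rw [tsum_bool, lintegral_add_left (measurable_comp_child (pick p T) T false
    fun T' => treeLaw D (failSet pick bad k (false :: p) T'))]
  exact add_le_add (hb false) (hb true)

/-! ### The phases, in each of which the diameter is halved -/

/-- One phase of the argument, in which the diameter is to drop from `big` to `small`. The potential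
`Φ` is at least one on cells that have not reached the goal, and its sum over the children is at
most `lam * Φ` in expectation; `G` bounds the probability of a failure in the later phases. -/
theorem treeLaw_failSet_phase {D : ℕ} [NeZero D] {pick : Node → Finset (Pt D) → Pt D}
    (hpick : ∀ a T, T.Nonempty → pick a T ∈ T) {bad big small : Finset (Pt D) → Prop}
    (hbig : ∀ T T', T' ⊆ T → big T → big T') {S : Finset (Pt D)} {k₀ : ℕ}
    {Φ G : Finset (Pt D) → ℝ≥0∞} {lam : ℝ≥0∞}
    (hG : ∀ p, ∀ T ⊆ S, small T → treeLaw D (failSet pick bad k₀ p T) ≤ G T)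
    (hΦ : ∀ T ⊆ S, ¬ small T → 1 ≤ Φ T)
    (hGstep : ∀ T ⊆ S, ∀ x, (T.Nonempty → x ∈ T) →
      ∫⁻ ξ, (G (child x T ξ false) + G (child x T ξ true))
        ∂(directionLaw D).prod offsetLaw ≤ G T)
    (hΦstep : ∀ T ⊆ S, big T → ∀ x, (T.Nonempty → x ∈ T) →
      ∫⁻ ξ, (Φ (child x T ξ false) + Φ (child x T ξ true))
        ∂(directionLaw D).prod offsetLaw ≤ lam * Φ T)
    (k : ℕ) (p : Node) {T : Finset (Pt D)} (hT : T ⊆ S) (hTb : big T) :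
    treeLaw D (failSet pick bad (k₀ + k) p T) ≤ lam ^ k * Φ T + G T := by
  induction k generalizing p T with
  | zero =>
    rw [pow_zero, one_mul]
    by_cases hs : small T
    · exact (hG p T hT hs).trans le_add_self
    · exact prob_le_one.trans ((hΦ T hT hs).trans le_self_add)
  | succ k ih =>
    have hx : T.Nonempty → pick p T ∈ T := hpick p T
    have hc (ξ : Choice D) (b : Bool) :
        treeLaw D (failSet pick bad (k₀ + k) (b :: p) (child (pick p T) T ξ b)) ≤
          lam ^ k * Φ (child (pick p T) T ξ b) + G (child (pick p T) T ξ b) :=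
      ih _ ((child_subset _ _ _ _).trans hT) (hbig _ _ (child_subset _ _ _ _) hTb)
    have hm := measurable_comp_child_add (pick p T) T
    calc treeLaw D (failSet pick bad (k₀ + (k + 1)) p T)
        ≤ ∫⁻ ξ, (treeLaw D (failSet pick bad (k₀ + k) (false :: p) (child (pick p T) T ξ false)) +
            treeLaw D (failSet pick bad (k₀ + k) (true :: p) (child (pick p T) T ξ true)))
            ∂(directionLaw D).prod offsetLaw := treeLaw_failSet_succ_le pick bad (k₀ + k) p T
      _ ≤ ∫⁻ ξ, (lam ^ k * (Φ (child (pick p T) T ξ false) + Φ (child (pick p T) T ξ true)) +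
            (G (child (pick p T) T ξ false) + G (child (pick p T) T ξ true)))
            ∂(directionLaw D).prod offsetLaw := by
          refine lintegral_mono fun ξ => (add_le_add (hc ξ false) (hc ξ true)).trans (le_of_eq ?_)
          ring
      _ ≤ lam ^ k * (lam * Φ T) + G T := by
          rw [lintegral_add_right _ (hm G), lintegral_const_mul _ (hm Φ)]
          gcongr
          · exact hΦstep T hT hTb _ hx
          · exact hGstep T hT _ hx
      _ = lam ^ (k + 1) * Φ T + G T := by rw [pow_succ, mul_assoc]

/-- All distances in `T` are at most `Δ`. -/
def DiamLE {D : ℕ} (Δ : ℝ) (T : Finset (Pt D)) : Prop := ∀ z ∈ T, ∀ z' ∈ T, ‖z - z'‖ ≤ Δ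

theorem DiamLE.subset {D : ℕ} {Δ : ℝ} {T T' : Finset (Pt D)} (h : DiamLE Δ T) (hT : T' ⊆ T) :
    DiamLE Δ T' := fun z hz z' hz' => h z (hT hz) z' (hT hz')

theorem exists_diamLE {D : ℕ} (T : Finset (Pt D)) : ∃ Δ, 0 < Δ ∧ DiamLE Δ T := by
  obtain ⟨Δ, hΔ⟩ := (T.finite_toSet.isBounded : Bornology.IsBounded (T : Set (Pt D))).exists_norm_le
  refine ⟨2 * |Δ| + 1, by positivity, fun z hz z' hz' => ?_⟩
  have h1 := hΔ z hz
  have h2 := hΔ z' hz'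
  have := norm_sub_le z z'
  have := le_abs_self Δ
  linarith

open Classical in
/-- The pairs of balls of radius `r` with centers in `C` at distance at least `ρ`. -/
noncomputable def farPairs {D : ℕ} (C : Finset (Pt D)) (r ρ : ℝ) : Finset (Pt D × Pt D) :=
  (C ×ˢ C).filter fun c => ∀ z ∈ Metric.closedBall c.1 r, ∀ z' ∈ Metric.closedBall c.2 r,
    ρ ≤ ‖z - z'‖

theorem mem_farPairs {D : ℕ} {C : Finset (Pt D)} {r ρ : ℝ} {c : Pt D × Pt D} :
    c ∈ farPairs C r ρ ↔ (c.1 ∈ C ∧ c.2 ∈ C) ∧ ∀ z ∈ Metric.closedBall c.1 r,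
      ∀ z' ∈ Metric.closedBall c.2 r, ρ ≤ ‖z - z'‖ := by
  classical
  unfold farPairs
  rw [Finset.mem_filter, Finset.mem_product]

theorem card_farPairs_le {D : ℕ} (C : Finset (Pt D)) (r ρ : ℝ) :
    (farPairs C r ρ).card ≤ C.card ^ 2 := by
  classical
  unfold farPairs
  exact (Finset.card_filter_le _ _).trans (by rw [Finset.card_product, sq])

/-- The number of pairs of balls of radius `r` with centers in `C` and at distance at least `ρ`,
both of which the cell with data `T` meets. -/
noncomputable def meetCount {D : ℕ} (C : Finset (Pt D)) (r ρ : ℝ) (T : Finset (Pt D)) : ℝ≥0∞ :=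
  ∑ c ∈ farPairs C r ρ, meet (Metric.closedBall c.1 r) (Metric.closedBall c.2 r) T

theorem meetCount_le {D : ℕ} (C : Finset (Pt D)) (r ρ : ℝ) (T : Finset (Pt D)) :
    meetCount C r ρ T ≤ (C.card ^ 2 : ℕ) := by
  refine (Finset.sum_le_card_nsmul _ _ 1 fun c _ => meet_le_one _ _ _).trans ?_
  rw [nsmul_eq_mul, mul_one]
  exact_mod_cast card_farPairs_le C r ρ

theorem lintegral_meetCount_child_le {D d : ℕ} [NeZero D] {T : Finset (Pt D)} {x : Pt D}
    (hx : T.Nonempty → x ∈ T) (hT : IsDoubling (T : Set (Pt D)) d) (hd : 1 ≤ d)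
    (C : Finset (Pt D)) {r ρ Δ : ℝ} (hr : 0 < r) (hρ : 1680 * (r * √d) ≤ ρ)
    (hΔ : 0 < Δ) (hdiam : DiamLE Δ T) :
    ∫⁻ ξ, (meetCount C r ρ (child x T ξ false) + meetCount C r ρ (child x T ξ true))
        ∂(directionLaw D).prod offsetLaw ≤
      ENNReal.ofReal (1 - ρ / (240 * Δ)) * meetCount C r ρ T := by
  unfold meetCount
  simp_rw [← Finset.sum_add_distrib, Finset.mul_sum]
  rw [lintegral_finsetSum _ fun c _ => measurable_comp_child_add x T
    (meet (Metric.closedBall c.1 r) (Metric.closedBall c.2 r))]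
  exact Finset.sum_le_sum fun c hc => lintegral_meet_child_le hx hT hd hr hρ
    (mem_farPairs.1 hc).2 hΔ hdiam

/-- Two points of the cell at distance more than `Δ` lie in balls that are far from each other. -/
theorem one_le_meetCount {D : ℕ} {C T : Finset (Pt D)} {r Δ : ℝ}
    (hC : ∀ z ∈ T, ∃ c ∈ C, z ∈ Metric.closedBall c r) (hr : 8 * r ≤ Δ) (hT : ¬ DiamLE Δ T) :
    1 ≤ meetCount C r (Δ / 2) T := by
  unfold DiamLE at hT
  push Not at hT
  obtain ⟨z, hz, z', hz', hlt⟩ := hT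
  obtain ⟨c, hc, hzc⟩ := hC z hz
  obtain ⟨c', hc', hzc'⟩ := hC z' hz'
  have hm : meet (Metric.closedBall c r) (Metric.closedBall c' r) T = 1 :=
    if_pos ⟨⟨z, hz, hzc⟩, ⟨z', hz', hzc'⟩⟩
  rw [← hm]
  refine Finset.single_le_sum (f := fun c : Pt D × Pt D =>
    meet (Metric.closedBall c.1 r) (Metric.closedBall c.2 r) T) (fun _ _ => zero_le)
    (a := (c, c')) (mem_farPairs.2 ⟨⟨hc, hc'⟩, fun w hw w' hw' => ?_⟩)
  rw [Metric.mem_closedBall] at hzc hzc' hw hw'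
  rw [← dist_eq_norm] at hlt ⊢
  have h1 := dist_triangle4 z w w' z'
  have h2 := dist_triangle_right z w c
  have h3 := dist_triangle_right w' z' c'
  linarith

/-- The union bound over all phases, the target diameter being `δ` and the initial one `2 ^ J δ`. -/
theorem treeLaw_failSet_le_sum {D d : ℕ} [NeZero D] {pick : Node → Finset (Pt D) → Pt D}
    (hpick : ∀ a T, T.Nonempty → pick a T ∈ T) {S C : Finset (Pt D)}
    (hS : IsDoubling (S : Set (Pt D)) d) (hd : 1 ≤ d) {r δ : ℝ} (hr : 0 < r)
    (hC : ∀ z ∈ S, ∃ c ∈ C, z ∈ Metric.closedBall c r) (hr8 : 8 * r ≤ δ)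
    (hrd : 3360 * (r * √d) ≤ δ) (K J : ℕ) (p : Node) {T : Finset (Pt D)} (hT : T ⊆ S)
    (hTJ : DiamLE (2 ^ J * δ) T) :
    treeLaw D (failSet pick (fun T => ¬ DiamLE δ T) (J * K) p T) ≤
      ∑ i ∈ Finset.range J, ENNReal.ofReal (959 / 960) ^ K * meetCount C r (2 ^ i * δ / 2) T := by
  have hδ : 0 < δ := by linarith
  have hρ (i : ℕ) : 1680 * (r * √d) ≤ 2 ^ i * δ / 2 := by
    have : δ ≤ 2 ^ i * δ := le_mul_of_one_le_left hδ.le (one_le_pow₀ (by norm_num))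
    linarith
  induction J generalizing p T with
  | zero =>
    have hT0 : DiamLE δ T := by simpa using hTJ
    simp [failSet, desc, hT0]
  | succ J ih =>
    rw [Finset.sum_range_succ, Nat.succ_mul, add_comm (Finset.sum _ _)]
    refine treeLaw_failSet_phase hpick (big := DiamLE (2 ^ (J + 1) * δ))
      (small := DiamLE (2 ^ J * δ))
      (fun T T' hTT' h => h.subset hTT') (S := S)
      (Φ := meetCount C r (2 ^ J * δ / 2))
      (G := fun T => ∑ i ∈ Finset.range J, ENNReal.ofReal (959 / 960) ^ K *
        meetCount C r (2 ^ i * δ / 2) T)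
      (fun p T hTS hTs => ih p hTS hTs) (fun T hTS hTs => ?_) (fun T hTS x hx => ?_)
      (fun T hTS hTb x hx => ?_) K p hT hTJ
    · refine one_le_meetCount (fun z hz => hC z (hTS hz)) (hr8.trans ?_) hTs
      exact le_mul_of_one_le_left hδ.le (one_le_pow₀ (by norm_num))
    -- the diameter of `T` is now irrelevant: the factor is at most one for any bound `Δ` of it
    · obtain ⟨Δ, hΔ, hTΔ⟩ := exists_diamLE T
      simp_rw [← Finset.sum_add_distrib, ← mul_add]
      rw [lintegral_finsetSum _ fun i _ =>
        (measurable_comp_child_add x T _).const_mul _]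
      refine Finset.sum_le_sum fun i _ => ?_
      rw [lintegral_const_mul _ (measurable_comp_child_add x T _)]
      gcongr
      refine (lintegral_meetCount_child_le hx (hS.subset (by exact_mod_cast hTS)) hd C hr (hρ i) hΔ
        hTΔ).trans (mul_le_of_le_one_left' ?_)
      rw [ENNReal.ofReal_le_one]
      have : 0 ≤ 2 ^ i * δ / 2 / (240 * Δ) := by positivity
      linarith
    · refine (lintegral_meetCount_child_le hx (hS.subset (by exact_mod_cast hTS)) hd C hr (hρ J)
        (by positivity) hTb).trans (le_of_eq ?_)
      congr 2
      rw [pow_succ]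
      field_simp
      norm_num

theorem treeLaw_failSet_le {D d : ℕ} [NeZero D] {pick : Node → Finset (Pt D) → Pt D}
    (hpick : ∀ a T, T.Nonempty → pick a T ∈ T) {S C : Finset (Pt D)}
    (hS : IsDoubling (S : Set (Pt D)) d) (hd : 1 ≤ d) {r δ : ℝ} (hr : 0 < r)
    (hC : ∀ z ∈ S, ∃ c ∈ C, z ∈ Metric.closedBall c r) (hr8 : 8 * r ≤ δ)
    (hrd : 3360 * (r * √d) ≤ δ) (K J : ℕ) (p : Node) (hSJ : DiamLE (2 ^ J * δ) S) :
    treeLaw D (failSet pick (fun T => ¬ DiamLE δ T) (J * K) p S) ≤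
      ENNReal.ofReal (J * ((959 / 960) ^ K * C.card ^ 2)) := by
  refine (treeLaw_failSet_le_sum hpick hS hd hr hC hr8 hrd K J p subset_rfl hSJ).trans ?_
  refine (Finset.sum_le_card_nsmul _ _ _ fun i _ =>
    mul_le_mul_right (meetCount_le _ _ _ _) _).trans (le_of_eq ?_)
  rw [Finset.card_range, nsmul_eq_mul, ENNReal.ofReal_mul (by positivity),
    ENNReal.ofReal_mul (by positivity), ENNReal.ofReal_pow (by norm_num), ENNReal.ofReal_natCast]
  congr 2
  rw [← Nat.cast_pow, ENNReal.ofReal_natCast]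

/-! ### Radius, and the choice of the parameters -/

theorem radius_set_nonempty {D : ℕ} (T : Finset (Pt D)) :
    {r : ℝ | 0 ≤ r ∧ ∃ x : Pt D, (T : Set (Pt D)) ⊆ Metric.closedBall x r}.Nonempty := by
  have hT : Bornology.IsBounded (T : Set (Pt D)) := T.finite_toSet.isBounded
  obtain ⟨Δ, hΔ⟩ := hT.subset_closedBall 0
  exact ⟨max Δ 0, le_max_right _ _, 0,
    hΔ.trans (Metric.closedBall_subset_closedBall (le_max_left _ _))⟩

theorem radius_nonneg {D : ℕ} (T : Finset (Pt D)) : 0 ≤ radius T :=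
  le_csInf (radius_set_nonempty T) fun _ h => h.1

theorem radius_le {D : ℕ} {T : Finset (Pt D)} {r : ℝ} (hr : 0 ≤ r) {x : Pt D}
    (h : (T : Set (Pt D)) ⊆ Metric.closedBall x r) : radius T ≤ r :=
  csInf_le ⟨0, fun _ h => h.1⟩ ⟨hr, x, h⟩

theorem radius_mono {D : ℕ} {T T' : Finset (Pt D)} (h : T ⊆ T') : radius T ≤ radius T' :=
  le_csInf (radius_set_nonempty T') fun _ hr => by
    obtain ⟨hr, x, hx⟩ := hr
    exact radius_le hr ((Finset.coe_subset.2 h).trans hx)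

theorem radius_le_of_diamLE {D : ℕ} {T : Finset (Pt D)} {Δ : ℝ} (hΔ : 0 ≤ Δ) (h : DiamLE Δ T) :
    radius T ≤ Δ := by
  obtain rfl | ⟨x, hx⟩ := T.eq_empty_or_nonempty
  · exact radius_le hΔ (x := 0) (by simp)
  · refine radius_le hΔ (x := x) fun z hz => ?_
    rw [Metric.mem_closedBall, dist_eq_norm]
    exact h z hz x hx

theorem exists_subset_closedBall {D : ℕ} {T : Finset (Pt D)} (h : 0 < radius T) :
    ∃ x : Pt D, (T : Set (Pt D)) ⊆ Metric.closedBall x (2 * radius T) := by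
  obtain ⟨r, ⟨_, x, hx⟩, hlt⟩ := exists_lt_of_csInf_lt (radius_set_nonempty T)
    (show radius T < 2 * radius T by linarith)
  exact ⟨x, hx.trans (Metric.closedBall_subset_closedBall hlt.le)⟩

/-- A set of doubling dimension zero has at most one point. -/
theorem radius_eq_zero_of_isDoubling_zero {D : ℕ} {T : Finset (Pt D)}
    (h : IsDoubling (T : Set (Pt D)) 0) : radius T = 0 := by
  by_contra hne
  have hR : 0 < radius T := lt_of_le_of_ne (radius_nonneg T) (Ne.symm hne)
  obtain ⟨x, hx⟩ := exists_subset_closedBall hR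
  obtain ⟨C, hC, hcov⟩ := h.exists_cover x (r := 2 * radius T) (by positivity) 2
  have hC1 : C.card ≤ 1 := by simpa using hC
  obtain ⟨z, hz⟩ : T.Nonempty := by
    by_contra he
    rw [Finset.not_nonempty_iff_eq_empty] at he
    have := radius_le_of_diamLE le_rfl (show DiamLE 0 T by simp [DiamLE, he])
    linarith
  obtain ⟨c, hc, _⟩ := hcov z hz (hx hz)
  have : radius T ≤ 2 * radius T / 2 ^ 2 := by
    refine radius_le (by positivity) (x := c) fun z' hz' => ?_
    obtain ⟨c', hc', hz''⟩ := hcov z' hz' (hx hz')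
    rwa [Finset.card_le_one.1 hC1 c hc c' hc']
  linarith

/-- The choice of the number `K = K₀ d L` of levels per phase: it outweighs the number of phases
and the number of pairs of balls. -/
theorem phases_mul_pow_le {K₀ d L J : ℕ} (hK₀ : (959 / 960 : ℝ) ^ K₀ ≤ (1 / 2) ^ 32) (hd : 1 ≤ d)
    (hL : 1 ≤ L) (hJ : J ≤ L + 2) {N : ℕ} (hN : N ≤ 2 ^ (d * (L + 13))) :
    (J : ℝ) * ((959 / 960) ^ (K₀ * d * L) * N ^ 2) ≤ 1 / 4 := by
  have h1 : (959 / 960 : ℝ) ^ (K₀ * d * L) ≤ 1 / 2 ^ (32 * (d * L)) := by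
    rw [mul_assoc, pow_mul, pow_mul 2, ← one_div_pow, ← one_div_pow]
    gcongr
  have h2 : J ≤ 2 ^ (L + 1) := by
    refine hJ.trans ?_
    have := Nat.lt_two_pow_self (n := L)
    rw [pow_succ]
    omega
  have h3 : (J : ℝ) ≤ 2 ^ (L + 1) := by exact_mod_cast h2
  have h4 : (N : ℝ) ≤ 2 ^ (d * (L + 13)) := by exact_mod_cast hN
  have hdL : L ≤ d * L := Nat.le_mul_of_pos_left L hd
  have hdL' : d ≤ d * L := Nat.le_mul_of_pos_right d hL
  calc (J : ℝ) * ((959 / 960) ^ (K₀ * d * L) * N ^ 2)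
      ≤ 2 ^ (L + 1) * (1 / 2 ^ (32 * (d * L)) * (2 ^ (d * (L + 13))) ^ 2) := by gcongr
    _ = 2 ^ (L + 1 + d * (L + 13) * 2) / 2 ^ (32 * (d * L)) := by
        rw [← pow_mul, pow_add 2 (L + 1)]; ring
    _ ≤ 1 / 4 := by
        rw [div_le_div_iff₀ (by positivity) (by norm_num), one_mul,
          show (4 : ℝ) = 2 ^ 2 by norm_num, ← pow_add]
        refine pow_le_pow_right₀ (by norm_num) ?_
        have : d * (L + 13) * 2 = 2 * (d * L) + 26 * d := by ring
        omega

end RPTree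

theorem theorem2 :
    ∃ c₃ : ℝ, 0 < c₃ ∧
      ∀ (D : ℕ), 1 ≤ D →
      ∀ (S : Finset (RPTree.Pt D)) (pick : RPTree.Node → Finset (RPTree.Pt D) → RPTree.Pt D),
        (∀ a T, T.Nonempty → pick a T ∈ T) →
      ∀ (ω₀ : RPTree.Node → RPTree.Choice D) (p : RPTree.Node) (d : ℕ),
        RPTree.doublingDim (RPTree.cell pick S ω₀ p : Set (RPTree.Pt D)) ≤ d →
      ∀ s : ℝ, 2 ≤ s →
        ∃ A : Set (RPTree.Node → RPTree.Choice D),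
          MeasurableSet A ∧ 3 / 4 ≤ RPTree.treeLaw D A ∧
          ∀ ω ∈ A, ∀ q : RPTree.Node,
            c₃ * Real.log s * (d * Real.log (s * d)) < q.length →
            RPTree.radius (RPTree.cell pick S (RPTree.resample p ω₀ ω) (q ++ p)) ≤
              RPTree.radius (RPTree.cell pick S ω₀ p) / s := by
  obtain ⟨K₀, hK₀⟩ := exists_pow_lt_of_lt_one (show (0 : ℝ) < (1 / 2) ^ 32 by positivity)
    (show (959 / 960 : ℝ) < 1 by norm_num)
  have hl2 : 0 < Real.log 2 := Real.log_pos (by norm_num)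
  -- `a + 2 ≤ 4 log₂ s` phases of `K₀ d L` levels each, where `L ≤ 2 log₂ (s d)`
  refine ⟨8 * (K₀ + 1) / Real.log 2 ^ 2, by positivity, ?_⟩
  intro D hD S pick hpick ω₀ p d hdim s hs
  have : NeZero D := ⟨by omega⟩
  set T₀ := RPTree.cell pick S ω₀ p with hT₀
  have hdoub := RPTree.isDoubling_of_doublingDim_le hdim
  have hs0 : 0 < s := by linarith
  simp_rw [RPTree.cell_resample_append, ← hT₀]
  have hsub (ω : RPTree.Node → RPTree.Choice D) (q : RPTree.Node) :
      RPTree.desc pick p T₀ ω q ⊆ T₀ := by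
    simpa [RPTree.desc] using RPTree.desc_append_subset pick p T₀ ω [] q
  -- a cell of radius zero, in particular the case `d = 0`, needs no randomness
  rcases (RPTree.radius_nonneg T₀).eq_or_lt with hR | hR
  · refine ⟨Set.univ, .univ, ?_, fun ω _ q _ => ?_⟩
    · rw [measure_univ]
      exact ENNReal.div_le_of_le_mul (by norm_num)
    · rw [← hR, zero_div, hR]
      exact RPTree.radius_mono (hsub ω q)
  have hd : 1 ≤ d := by
    by_contra! h
    obtain rfl : d = 0 := by omega
    exact hR.ne' (RPTree.radius_eq_zero_of_isDoubling_zero hdoub)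
  have hd1 : (1 : ℝ) ≤ d := by exact_mod_cast hd
  set R := RPTree.radius T₀ with hRdef
  have hsd : s ≤ s * d := le_mul_of_one_le_right hs0.le hd1
  have hlogs : 1 ≤ Real.logb 2 s := by
    rw [Real.le_logb_iff_rpow_le (by norm_num) hs0]
    simpa using hs
  have hlogsd : Real.logb 2 s ≤ Real.logb 2 (s * d) :=
    Real.logb_le_logb_of_le (by norm_num) hs0 hsd
  set a := ⌈Real.logb 2 s⌉₊ with ha
  set L := ⌈Real.logb 2 (s * d)⌉₊ with hL
  have haL : a ≤ L := Nat.ceil_mono hlogsd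
  have hpow (y : ℝ) (hy : 0 < y) : y ≤ 2 ^ ⌈Real.logb 2 y⌉₊ := by
    have := Nat.le_ceil (Real.logb 2 y)
    rwa [Real.logb_le_iff_le_rpow (by norm_num) hy, Real.rpow_natCast] at this
  have hsa : s ≤ 2 ^ a := hpow s hs0
  have hsdL : s * d ≤ 2 ^ L := hpow _ (by positivity)
  have ha1 : (a : ℝ) < Real.logb 2 s + 1 := Nat.ceil_lt_add_one (by linarith)
  have hL1 : (L : ℝ) < Real.logb 2 (s * d) + 1 := Nat.ceil_lt_add_one (by linarith)
  have hLpos : 1 ≤ L := Nat.one_le_ceil_iff.2 (by linarith)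
  obtain ⟨x, hx⟩ := RPTree.exists_subset_closedBall hR
  obtain ⟨C, hCcard, hC⟩ := hdoub.exists_cover x (r := 2 * R) (by positivity) (L + 13)
  set δ := R / s with hδ
  set r := 2 * R / 2 ^ (L + 13) with hr
  have hsqrt : √(d : ℝ) ≤ d := Real.sqrt_le_iff.2 ⟨by linarith, by nlinarith⟩
  have hsqrt1 : 1 ≤ √(d : ℝ) := Real.one_le_sqrt.2 hd1
  have hr0 : 0 < r := by positivity
  have hrd : 3360 * (r * √d) ≤ δ := by
    rw [hr, hδ, le_div_iff₀ hs0, pow_add]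
    have h1 : s * √d ≤ 2 ^ L := le_trans (by gcongr) hsdL
    have h2 : R * (s * √d) ≤ R * 2 ^ L := by gcongr
    rw [show 3360 * (2 * R / (2 ^ L * 2 ^ 13) * √(d : ℝ)) * s =
      (6720 / 8192 * (R * (s * √d))) / 2 ^ L by field_simp; norm_num, div_le_iff₀ (by positivity)]
    have : 0 ≤ R * 2 ^ L := by positivity
    linarith
  have hr8 : 8 * r ≤ δ := by
    refine le_trans ?_ hrd
    have : r ≤ r * √d := le_mul_of_one_le_right hr0.le hsqrt1
    linarith
  have hdiam : RPTree.DiamLE (2 ^ (a + 2) * δ) T₀ := fun z hz z' hz' => by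
    have h1 := hx hz
    have h2 := hx hz'
    rw [Metric.mem_closedBall] at h1 h2
    have h3 := dist_triangle_right z z' x
    rw [dist_eq_norm] at h3
    have h4 : 4 * R ≤ 2 ^ (a + 2) * δ := by
      rw [hδ, pow_add, mul_div_assoc', le_div_iff₀ hs0]
      nlinarith
    linarith
  set K := K₀ * d * L with hK
  have hfail := RPTree.treeLaw_failSet_le hpick hdoub hd hr0 (fun z hz => hC z hz (hx hz)) hr8 hrd
    K (a + 2) p hdiam
  refine ⟨(RPTree.failSet pick (fun T => ¬ RPTree.DiamLE δ T) ((a + 2) * K) p T₀)ᶜ,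
    (RPTree.measurableSet_failSet _ _ _ _ _).compl, ?_, fun ω hω q hq => ?_⟩
  · rw [prob_compl_eq_one_sub (RPTree.measurableSet_failSet _ _ _ _ _)]
    have h1 := hfail.trans (ENNReal.ofReal_le_ofReal
      (RPTree.phases_mul_pow_le hK₀.le hd hLpos (by omega) hCcard))
    refine le_trans ?_ (tsub_le_tsub_left h1 1)
    rw [← ENNReal.ofReal_one, ← ENNReal.ofReal_sub _ (by norm_num),
      show (3 / 4 : ℝ≥0∞) = ENNReal.ofReal (3 / 4) by
        rw [ENNReal.ofReal_div_of_pos (by norm_num)]; simp]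
    exact ENNReal.ofReal_le_ofReal (by norm_num)
  · have hlen : (a + 2) * K ≤ q.length := by
      have h1 : (((a + 2) * K : ℕ) : ℝ) ≤
          8 * (K₀ + 1) / Real.log 2 ^ 2 * Real.log s * (d * Real.log (s * d)) := by
        have e : 8 * (K₀ + 1) / Real.log 2 ^ 2 * Real.log s * (d * Real.log (s * d)) =
            4 * Real.logb 2 s * ((K₀ + 1) * d * (2 * Real.logb 2 (s * d))) := by
          rw [Real.logb, Real.logb]
          field_simp
          ring
        rw [e, hK]
        push_cast
        have : (0 : ℝ) ≤ K₀ := Nat.cast_nonneg _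
        gcongr
        · linarith
        · linarith
        · linarith
      exact_mod_cast (h1.trans_lt hq).le
    -- cells are nested, so it suffices to look at the ancestor exactly `(a + 2) K` levels below `p`
    have hq' : q = q.take (q.length - (a + 2) * K) ++ q.drop (q.length - (a + 2) * K) :=
      (List.take_append_drop _ _).symm
    set q₀ := q.drop (q.length - (a + 2) * K) with hq₀
    have hq₀len : q₀.length = (a + 2) * K := by
      rw [hq₀, List.length_drop]
      omega
    have hgood : RPTree.DiamLE δ (RPTree.desc pick p T₀ ω q₀) := by
      by_contra h
      exact hω ⟨q₀, hq₀len, h⟩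
    refine RPTree.radius_le_of_diamLE (by positivity) ?_
    rw [hq']
    exact hgood.subset (RPTree.desc_append_subset pick p T₀ ω q₀ _)
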